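/- Let $\mathcal H$ be a complex Hilbert space of finite dimension $d\ge 2$. A POVM $\mathbf P=\{P_i\}_{i\in I}$ is a finite family of non-negative operators on $\mathcal H$ with $\sum_{i\in I}P_i=\mathbf 1$. The support of $P_i$ is the subspace $\mathrm{Supp}(P_i)$ whose orthogonal is $\{\phi:\langle\phi|P_i|\phi\rangle=0\}$. $\mathbf P$ is rank-one if all the $P_i$ have rank one, and quasi-qubit if each $P_i$ has rank one or rank $d$. A channel is a completely positive identity-preserving linear map $\mathcal E$ from $\mathcal B(\mathcal H)$ to itself. For POVMs with the same index set, $\mathbf P$ is cleaner than $\mathbf Q$, written $\mathbf P\succ\mathbf Q$, if there is a channel $\mathcal E$ with $\mathcal E(P_i)=Q_i$ for all $i$. $\mathbf P$ is clean if $\mathbf Q\succ\mathbf P$ implies $\mathbf P\succ\mathbf Q$ for all $\mathbf Q$. $\mathbf P$ and $\mathbf Q$ are cleanness-equivalent if $\mathbf P\succ\mathbf Q$ and $\mathbf Q\succ\mathbf P$, and unitarily equivalent if there is a unitary $U$ with $UP_iU^*=Q_i$ for all $i$. Vectors $\{v_i\}_{i\in K}$ of $\mathcal H$ correspond to subspaces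 $\{F_i\}_{i\in K}$ if for each $i\in K$ there is a linear map $R_i$ on $\mathcal H$ with $R_i v_i\ne 0$ and $R_i v_j\in F_j$ for all $j\in K$. The family $\{F_i\}_{i\in K}$ totally determines $\mathcal H$ if for every family $\{v_i\}_{i\in K}$ corresponding to it there is, up to a complex multiplicative constant, only one linear map $R$ with $R v_i\in F_i$ for all $i\in K$. Consider the following algorithm, run on a quasi-qubit POVM $\mathbf P$. (1) If $\mathbf P$ is rank-one, exit with "clean". (2) Otherwise write the rank-one elements as $P_i=\lambda_i|\psi_i\rangle\langle\psi_i|$, $1\le i\le n$. If the $\psi_i$ do not span $\mathcal H$, exit with "not clean". (3) Otherwise number them so that $\psi_1,\dots,\psi_d$ is a basis of $\mathcal H$, and let $C=\{\mathrm{Span}(\psi_1),\dots,\mathrm{Span}(\psi_d)\}$. (4) For $i=d+1,\dots,n$: write $\psi_i=\sum_{V\in C}v_V$ with $v_V\in V$; replace in $C$ all the $V$ with $v_V\neq0$ by their sum; if now $C=\{\mathcal H\}$, exit with "clean". (5) When the loop is over, exit with "not clean". Let $\mathbf P=\{P_i\}_{i\in I}$ be a quasi-qubit POVM on $\mathcal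 H$, and let (*) be the condition: $\mathbf P$ is rank-one or the supports of its rank-one elements totally determine $\mathcal H$. Then: (a) If $\mathbf P$ has at least two outcomes ($|I|\ge2$), then $\mathbf P$ is clean if and only if (*) holds. (b) The algorithm decides (*): whatever choices are made in it, it terminates, with answer "clean" if (*) holds and "not clean" if (*) does not hold. (c) If $\mathbf P$ is clean, then a POVM $\mathbf Q$ with index set $I$ is cleanness-equivalent to $\mathbf P$ if and only if it is unitarily equivalent to $\mathbf P$. -/

import Mathlib

open scoped CStarAlgebra

noncomputable section

namespace CleanPOVM

/-- A linear map on `B(H)` that is completely positive and preserves the identity. -/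
structure Channel (H : Type*) [NormedAddCommGroup H] [InnerProductSpace ℂ H] [CompleteSpace H] where
  /-- the underlying completely positive map -/
  toCP : (H →L[ℂ] H) →CP (H →L[ℂ] H)
  map_one : toCP 1 = 1

/-- A POVM on `H` whose outcomes are labelled by the finite type `ι`. -/
structure POVM (ι H : Type*) [Fintype ι] [NormedAddCommGroup H] [InnerProductSpace ℂ H] where
  /-- the elements of the POVM -/
  elem : ι → (H →L[ℂ] H)
  nonneg : ∀ i, (elem i).IsPositive
  sum_eq_one : ∑ i, elem i = 1

section Operators

variable {H : Type*} [NormedAddCommGroup H] [InnerProductSpace ℂ H]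

/-- The rank of an operator. -/
def opRank (T : H →L[ℂ] H) : ℕ := Module.finrank ℂ (LinearMap.range (T : H →ₗ[ℂ] H))

/-- The support of a nonnegative operator `T`: the subspace whose orthogonal consists of the
vectors `φ` with `⟪φ, T φ⟫ = 0` (for nonnegative `T` these vectors form a subspace). -/
def supp (T : H →L[ℂ] H) : Submodule ℂ H :=
  (Submodule.span ℂ {φ : H | inner ℂ φ (T φ) = 0})ᗮ

end Operators

section Determination

variable {V I : Type*} [AddCommGroup V] [Module ℂ V]

/-- The vectors `v i` correspond to the subspaces `F i`. -/
def Corresponds (v : I → V) (F : I → Submodule ℂ V) : Prop :=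
  ∀ i, ∃ R : V →ₗ[ℂ] V, R (v i) ≠ 0 ∧ ∀ j, R (v j) ∈ F j

/-- The subspaces `F i` totally determine `V`: for every corresponding collection of vectors
`v i` there is, up to a multiplicative constant, only one linear map `R` with
`R (v i) ∈ F i` for all `i`. -/
def TotallyDetermines (F : I → Submodule ℂ V) : Prop :=
  ∀ v : I → V, Corresponds v F →
    ∃ R₀ : V →ₗ[ℂ] V, (∀ i, R₀ (v i) ∈ F i) ∧
      ∀ R : V →ₗ[ℂ] V, (∀ i, R (v i) ∈ F i) → ∃ c : ℂ, R = c • R₀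

end Determination

/-- The two possible answers of the algorithm. -/
inductive Verdict
  | clean
  | notClean

/-- The states of the algorithm.  `ι` labels the outcomes of the POVM. -/
inductive AlgState (ι H : Type*) [NormedAddCommGroup H] [InnerProductSpace ℂ H]
  /-- about to test whether the POVM is rank-one -/
  | checkRankOne : AlgState ι H
  /-- about to write down the rank-one elements and to test whether they generate the space -/
  | checkSpan : AlgState ι H
  /-- vectors `ψ i` have been written down, and those of the rank-one elements generate the
  space; about to select a basis and to initialize the collection of subspaces -/
  | chooseBasis (ψ : ι → H) : AlgState ι H
  /-- head of the loop: the current collection `C` and the vectors still to be treated -/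
  | loop (C : Finset (Submodule ℂ H)) (rest : List H) : AlgState ι H
  /-- end of the body of the loop: about to test whether `C` is reduced to the whole space -/
  | checkExit (C : Finset (Submodule ℂ H)) (rest : List H) : AlgState ι H
  /-- the algorithm has exited with an answer -/
  | exit (r : Verdict) : AlgState ι H

namespace POVM

variable {ι H : Type*} [Fintype ι] [NormedAddCommGroup H] [InnerProductSpace ℂ H]

/-- The outcome `i` has a rank-one element. -/
def RankOneAt (P : POVM ι H) (i : ι) : Prop := opRank (P.elem i) = 1

/-- All elements are rank-one. -/
def IsRankOne (P : POVM ι H) : Prop := ∀ i, P.RankOneAt i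

/-- Every element is full-rank or rank-one. -/
def IsQuasiQubit (P : POVM ι H) : Prop :=
  ∀ i, opRank (P.elem i) = Module.finrank ℂ H ∨ P.RankOneAt i

/-- The supports of the rank-one elements totally determine the space. -/
def RankOneSupportsDetermine (P : POVM ι H) : Prop :=
  TotallyDetermines fun i : {i : ι // P.RankOneAt i} => supp (P.elem i)

/-- `P` is cleaner than `Q`: some channel sends `P` to `Q`. -/
def Cleaner [CompleteSpace H] (P Q : POVM ι H) : Prop :=
  ∃ E : Channel H, ∀ i, E.toCP (P.elem i) = Q.elem i

/-- `P` is clean. -/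
def IsClean [CompleteSpace H] (P : POVM ι H) : Prop :=
  ∀ Q : POVM ι H, Q.Cleaner P → P.Cleaner Q

/-- Cleanness-equivalence. -/
def CleanEquiv [CompleteSpace H] (P Q : POVM ι H) : Prop := Q.Cleaner P ∧ P.Cleaner Q

/-- Unitary equivalence. -/
def UnitaryEquiv [CompleteSpace H] (P Q : POVM ι H) : Prop :=
  ∃ U ∈ unitary (H →L[ℂ] H), ∀ i, U * P.elem i * star U = Q.elem i

/-- `ψ` is a way of writing the rank-one elements as `P i = a i • |ψ i⟩⟨ψ i|`. -/
def Represents (P : POVM ι H) (ψ : ι → H) : Prop :=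
  ∀ i, P.RankOneAt i → ∃ a : ℝ, P.elem i = (a : ℂ) • InnerProductSpace.rankOne ℂ (ψ i) (ψ i)

open Classical in
/-- One step of the algorithm run on the POVM `P`.  The relation is not functional: it allows every
choice of the vectors `ψ`, of the basis among them, and of the order of the remaining vectors. -/
inductive Step (P : POVM ι H) : AlgState ι H → AlgState ι H → Prop
  | rankOne : P.IsRankOne → Step P .checkRankOne (.exit .clean)
  | notRankOne : ¬ P.IsRankOne → Step P .checkRankOne .checkSpan
  | notSpanning (ψ : ι → H) : P.Represents ψ →
      Submodule.span ℂ (ψ '' {i | P.RankOneAt i}) ≠ ⊤ →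
      Step P .checkSpan (.exit .notClean)
  | spanning (ψ : ι → H) : P.Represents ψ →
      Submodule.span ℂ (ψ '' {i | P.RankOneAt i}) = ⊤ →
      Step P .checkSpan (.chooseBasis ψ)
  /-- The rank-one outcomes are listed without repetition as `b` followed by `rest`, where the
  vectors of `b` form a basis; the collection is initialized with the lines they generate. -/
  | init (ψ : ι → H) (b rest : List ι) :
      (b ++ rest).Nodup → (∀ i, i ∈ b ++ rest ↔ P.RankOneAt i) →
      LinearIndependent ℂ (fun k : Fin b.length => ψ (b.get k)) →
      Submodule.span ℂ (Set.range fun k : Fin b.length => ψ (b.get k)) = ⊤ →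
      Step P (.chooseBasis ψ)
        (.loop (b.map fun i => Submodule.span ℂ {ψ i}).toFinset (rest.map ψ))
  /-- Body of the loop: write `x = ∑ v V` with `v V ∈ V` for `V ∈ C`, let `J` be the set of those
  `V` with `v V ≠ 0`, and replace the members of `J` by their sum. -/
  | update (C : Finset (Submodule ℂ H)) (x : H) (rest : List H) (v : Submodule ℂ H → H)
      (J : Finset (Submodule ℂ H)) :
      (∀ V ∈ C, v V ∈ V) → x = ∑ V ∈ C, v V → J = C.filter (fun V => v V ≠ 0) →
      Step P (.loop C (x :: rest)) (.checkExit (insert (J.sup id) (C \ J)) rest)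
  | exitClean (C : Finset (Submodule ℂ H)) (rest : List H) : C = {⊤} →
      Step P (.checkExit C rest) (.exit .clean)
  | nextRound (C : Finset (Submodule ℂ H)) (rest : List H) : C ≠ {⊤} →
      Step P (.checkExit C rest) (.loop C rest)
  | loopDone (C : Finset (Submodule ℂ H)) : Step P (.loop C []) (.exit .notClean)

/-- The algorithm, run on `P`, decides the proposition `A`: no execution goes on forever, and
every execution that cannot be continued has exited, with the answer `clean` if `A` holds and
with the answer `notClean` if `A` does not hold. -/
def AlgorithmDecides (P : POVM ι H) (A : Prop) : Prop :=
  (¬ ∃ s : ℕ → AlgState ι H, s 0 = .checkRankOne ∧ ∀ n, P.Step (s n) (s (n + 1))) ∧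
  ∀ t : AlgState ι H, Relation.ReflTransGen P.Step .checkRankOne t →
    (∀ t', ¬ P.Step t t') →
    (A ∧ t = .exit .clean) ∨ (¬ A ∧ t = .exit .notClean)

end POVM

end CleanPOVM

end

/-! The condition (*) suffices because it forces every `Q` cleaner than `P` to be unitarily
equivalent to `P`. By `exists_kraus` a channel from `Q` to `P` has the form `X ↦ ∑ k, (R k)* X (R
k)`. If the supports totally determine `H`, positivity makes each `(R k)*` map the range of `Q i`
into the support of `P i`, so all `(R k)*` are proportional to one operator, which unitality makes
unitary after rescaling (`unitaryEquiv_of_rankOneSupportsDetermine`). If `P` is rank-one, the trace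
identity makes `Q` rank-one with vectors of the same norms, and equality in Cauchy–Schwarz matches
the two Gram matrices up to phases (`unitaryEquiv_of_isRankOne`). This also gives (c).

For necessity, the supports `Span (ψ i)` totally determine `H` exactly when the `ψ i` do not lie in
the union of two nonzero complementary subspaces (`Represents.rankOneSupportsDetermine_iff`). Given
such a splitting, one perturbs the full-rank elements along off-diagonal operators. A pinching
undoes the perturbation, so the perturbed and renormalized POVM is cleaner than `P`. If `P` were
clean, lower bounds on the full-rank elements would survive, so the perturbation could be prolonged
until the perturbed elements acquire a common kernel (`IsClean.exists_common_kernel`). For a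
suitable choice of splitting such a kernel is impossible (`not_isClean`).

The algorithm computes the finest such splitting: its blocks are independent, span `H`, contain all
vectors treated so far, and carry only scalar restrictions of operators having these vectors as
eigenvectors (`IsBlockDecomposition`). The vectors split if and only if the final collection is not
`{⊤}`. -/

namespace CleanPOVM

/-! ### Kraus form of completely positive maps -/

section Kraus

variable {H : Type*} [NormedAddCommGroup H] [InnerProductSpace ℂ H] [CompleteSpace H]

/-- The map `X ↦ ∑ k, (R k)* X (R k)`. -/
noncomputable def krausMap {κ : Type*} [Fintype κ] (R : κ → H →L[ℂ] H) :
    (H →L[ℂ] H) →ₗ[ℂ] (H →L[ℂ] H) :=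
  ∑ k, (LinearMap.mulLeft ℂ (star (R k))) ∘ₗ LinearMap.mulRight ℂ (R k)

theorem krausMap_apply {κ : Type*} [Fintype κ] (R : κ → H →L[ℂ] H) (X : H →L[ℂ] H) :
    krausMap R X = ∑ k, star (R k) * X * R k := by
  simp [krausMap, mul_assoc]

/-- A map in Kraus form is completely positive. -/
noncomputable def krausCP {κ : Type*} [Fintype κ] (R : κ → H →L[ℂ] H) :
    (H →L[ℂ] H) →CP (H →L[ℂ] H) where
  toLinearMap := krausMap R
  map_cstarMatrix_nonneg' n M hM := by
    -- Entrywise application is a sum of conjugations by the diagonal matrices with entry `R k`, and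
    -- conjugation preserves positivity.
    have h : M.map (krausMap R) = ∑ k,
        star (CStarMatrix.ofMatrix (Matrix.diagonal fun _ : Fin n => R k)) * M *
          CStarMatrix.ofMatrix (Matrix.diagonal fun _ : Fin n => R k) := by
      ext1 i j
      have hs : ∀ f : κ → CStarMatrix (Fin n) (Fin n) (H →L[ℂ] H),
          (∑ k, f k) i j = ∑ k, f k i j := fun f => Matrix.sum_apply i j _ f
      rw [hs, CStarMatrix.map_apply, krausMap_apply]
      refine Finset.sum_congr rfl fun k _ => ?_
      rw [CStarMatrix.mul_apply, Finset.sum_eq_single j]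
      · rw [CStarMatrix.mul_apply, Finset.sum_eq_single i]
        · simp [CStarMatrix.star_apply]
        · intro l _ hl
          simp [CStarMatrix.star_apply, Matrix.diagonal_apply_ne _ hl]
        · simp
      · intro l _ hl
        simp [Matrix.diagonal_apply_ne _ hl]
      · simp
    change 0 ≤ M.map (krausMap R)
    rw [h]
    exact Finset.sum_nonneg fun k _ => star_left_conjugate_nonneg hM _

/-- A unital map in Kraus form, as a channel. -/
noncomputable def krausChannel {κ : Type*} [Fintype κ] (R : κ → H →L[ℂ] H)
    (h : ∑ k, star (R k) * R k = 1) : Channel H where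
  toCP := krausCP R
  map_one := by
    change krausMap R 1 = 1
    simpa [krausMap_apply] using h

theorem krausChannel_apply {κ : Type*} [Fintype κ] (R : κ → H →L[ℂ] H)
    (h : ∑ k, star (R k) * R k = 1) (X : H →L[ℂ] H) :
    (krausChannel R h).toCP X = ∑ k, star (R k) * X * R k :=
  krausMap_apply R X

/-- Nonnegative elements are sums of products `star N * N`, and each row of each `N` supplies one
family `B k`. -/
theorem exists_gram_of_nonneg {n : Type*} [Fintype n] [DecidableEq n]
    {M : CStarMatrix n n (H →L[ℂ] H)} (hM : 0 ≤ M) :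
    ∃ (κ : Type) (_ : Fintype κ) (B : κ → n → H →L[ℂ] H),
      ∀ i j, M i j = ∑ k, star (B k i) * B k j := by
  rw [StarOrderedRing.nonneg_iff] at hM
  induction hM using AddSubmonoid.closure_induction with
  | mem x hx =>
    obtain ⟨N, rfl⟩ := hx
    obtain ⟨m, ⟨e⟩⟩ := Finite.exists_equiv_fin n
    refine ⟨Fin m, inferInstance, fun k i => N (e.symm k) i, fun i j => ?_⟩
    change (star N * N) i j = _
    rw [CStarMatrix.mul_apply, ← e.symm.sum_comp]
    rfl
  | zero => exact ⟨Empty, inferInstance, fun k => k.elim, fun i j => by simp⟩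
  | add x y _ _ hx hy =>
    obtain ⟨κ₁, _, B₁, h₁⟩ := hx
    obtain ⟨κ₂, _, B₂, h₂⟩ := hy
    exact ⟨κ₁ ⊕ κ₂, inferInstance, Sum.elim B₁ B₂, fun i j => by simp [h₁, h₂]⟩

/-- Every completely positive map on `B(H)`, for `H` of finite dimension, has a Kraus form. -/
theorem exists_kraus [FiniteDimensional ℂ H] (E : (H →L[ℂ] H) →CP (H →L[ℂ] H)) :
    ∃ (κ : Type) (_ : Fintype κ) (R : κ → H →L[ℂ] H), ∀ X, E X = ∑ k, star (R k) * X * R k := by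
  set n := Module.finrank ℂ H
  rcases Nat.eq_zero_or_pos n with hn | hn
  · refine ⟨Empty, inferInstance, fun k => 0, fun X => ?_⟩
    have : Subsingleton H := Module.finrank_zero_iff.1 hn
    ext x
    exact Subsingleton.elim _ _
  set e : OrthonormalBasis (Fin n) ℂ H := stdOrthonormalBasis ℂ H
  let r (i j : Fin n) : H →L[ℂ] H := InnerProductSpace.rankOne ℂ (e i) (e j)
  have hr : ∀ i j k l, r i j * r k l = if j = k then r i l else 0 := by
    intro i j k l
    ext x
    simp only [r, mul_apply_eq_comp, InnerProductSpace.rankOne_apply, inner_smul_right,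
      orthonormal_iff_ite.1 e.orthonormal j k]
    split_ifs <;> simp
  have hrs : ∀ i j, star (r i j) = r j i := fun i j => by
    simp [r, ContinuousLinearMap.star_eq_adjoint]
  let z : Fin n := ⟨0, hn⟩
  -- With a single nonzero row of matrix units, `star N * N` is the block matrix of all matrix
  -- units. Applying `E` to its entries gives the Choi matrix, which is therefore nonnegative.
  let N : CStarMatrix (Fin n) (Fin n) (H →L[ℂ] H) :=
    CStarMatrix.ofMatrix fun k j => if k = z then r z j else 0
  have hN : star N * N = CStarMatrix.ofMatrix fun i j => r i j := by
    ext1 i j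
    rw [CStarMatrix.mul_apply, Finset.sum_eq_single z]
    · rw [CStarMatrix.star_apply]
      change star (if z = z then r z i else 0) * (if z = z then r z j else 0) = r i j
      simp [hrs, hr]
    · intro b _ hb
      rw [CStarMatrix.star_apply]
      change star (if b = z then r z i else 0) * (if b = z then r z j else 0) = 0
      simp [hb]
    · simp
  have hpos := E.map_cstarMatrix_nonneg (CStarMatrix.ofMatrix fun i j => r i j)
    (hN ▸ star_mul_self_nonneg N)
  obtain ⟨κ, _, B, hB⟩ := exists_gram_of_nonneg hpos
  have hB' : ∀ i j, E (r i j) = ∑ k, star (B k i) * B k j := hB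
  -- The second index is summed because `∑ l, r l i * X * r j l` is the `(i, j)` coefficient of `X`
  -- times the identity.
  refine ⟨κ × Fin n, inferInstance, fun p => ∑ j, r j p.2 * B p.1 j, fun X => ?_⟩
  have hX : X = ∑ i, ∑ j, (inner ℂ (e i) (X (e j))) • r i j := by
    ext x
    simp only [sum_apply, smul_apply, r,
      InnerProductSpace.rankOne_apply]
    conv_lhs => rw [← e.sum_repr' x, map_sum, ← e.sum_repr' (∑ j, X (inner ℂ (e j) x • e j))]
    refine Finset.sum_congr rfl fun i _ => ?_
    rw [inner_sum, Finset.sum_smul]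
    refine Finset.sum_congr rfl fun j _ => ?_
    rw [map_smul, inner_smul_right, smul_smul, mul_comm]
  have hXr : ∀ i j l, r l i * X * r j l = (inner ℂ (e i) (X (e j))) • r l l := by
    intro i j l
    ext x
    simp only [r, mul_apply_eq_comp, InnerProductSpace.rankOne_apply, map_smul,
      smul_apply, smul_smul, mul_comm]
  have hone : ∑ l, r l l = 1 := by
    ext x
    simp [r, sum_apply, e.sum_repr']
  have key : ∀ k : κ, ∑ l, star (∑ j, r j l * B k j) * X * (∑ j, r j l * B k j) =
      ∑ i, ∑ j, (inner ℂ (e i) (X (e j))) • (star (B k i) * B k j) := by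
    intro k
    calc _ = ∑ l, ∑ i, ∑ j, star (B k i) * ((inner ℂ (e i) (X (e j))) • r l l) * B k j := by
          refine Finset.sum_congr rfl fun l _ => ?_
          rw [star_sum, Finset.sum_mul, Finset.sum_mul]
          refine Finset.sum_congr rfl fun i _ => ?_
          rw [Finset.mul_sum]
          refine Finset.sum_congr rfl fun j _ => ?_
          rw [star_mul, hrs, ← hXr]
          simp only [mul_assoc]
      _ = ∑ i, ∑ j, ∑ l, star (B k i) * ((inner ℂ (e i) (X (e j))) • r l l) * B k j := by
          rw [Finset.sum_comm]
          exact Finset.sum_congr rfl fun i _ => Finset.sum_comm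
      _ = _ := by
          refine Finset.sum_congr rfl fun i _ => Finset.sum_congr rfl fun j _ => ?_
          rw [← Finset.sum_mul, ← Finset.mul_sum, ← Finset.smul_sum, hone]
          simp
  rw [Fintype.sum_prod_type, Finset.sum_congr rfl fun k _ => key k]
  conv_lhs => rw [hX]
  simp only [map_sum, map_smul, hB', Finset.smul_sum]
  rw [Finset.sum_comm' (t' := Finset.univ) (s' := fun _ => Finset.univ) (by simp)]
  rw [Finset.sum_comm]
  conv_rhs => rw [Finset.sum_comm]
  refine Finset.sum_congr rfl fun i _ => ?_
  rw [Finset.sum_comm]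

end Kraus

/-! ### Complementary subspaces and total determination by lines -/

section Decomposition

variable {V K : Type*} [AddCommGroup V] [Module ℂ V]

/-- The family `ψ` is contained in the union of two complementary nonzero subspaces, the range and
the kernel of `π`. -/
def Decomposes (ψ : K → V) : Prop :=
  ∃ π : V →ₗ[ℂ] V, IsIdempotentElem π ∧ π ≠ 0 ∧ π ≠ 1 ∧ ∀ i, π (ψ i) = ψ i ∨ π (ψ i) = 0

theorem eq_zero_or_eq_one_of_isIdempotentElem_smul {π : V →ₗ[ℂ] V} (hπ : IsIdempotentElem π)
    {c : ℂ} (h : π = c • 1) : π = 0 ∨ π = 1 := by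
  by_cases h0 : π = 0
  · exact Or.inl h0
  right
  have h1 : c • π = π := by
    conv_rhs => rw [← hπ.eq]
    conv_rhs => enter [1]; rw [h]
    simp
  have h2 : (c - 1) • π = 0 := by rw [sub_smul, h1, one_smul, sub_self]
  rcases smul_eq_zero.1 h2 with h3 | h3
  · rw [h, sub_eq_zero.1 h3, one_smul]
  · exact absurd h3 h0

theorem decomposes_of_isCompl {ψ : K → V} {A B : Submodule ℂ V} (hc : IsCompl A B) (h0 : A ≠ ⊥)
    (h1 : A ≠ ⊤) (h : ∀ i, ψ i ∈ A ∨ ψ i ∈ B) : Decomposes ψ := by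
  refine ⟨A.projection B hc, Submodule.isIdempotentElem_projection hc, fun h => h0 ?_,
    fun h => h1 ?_, fun i => (h i).imp (fun hi => ?_) fun hi => ?_⟩
  · rw [← Submodule.range_projection hc, h, LinearMap.range_zero]
  · rw [← Submodule.range_projection hc, h]
    exact LinearMap.range_id
  · exact Submodule.projection_apply_left hc ⟨_, hi⟩
  · exact Submodule.projection_apply_of_mem_right hc hi

/-- A functional vanishing on the span gives a rank-one idempotent killing every `ψ i`; it is not
the identity because the dimension is at least two. -/
theorem decomposes_of_span_ne_top [FiniteDimensional ℂ V] (hd : 2 ≤ Module.finrank ℂ V)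
    {ψ : K → V} (h : Submodule.span ℂ (Set.range ψ) ≠ ⊤) : Decomposes ψ := by
  obtain ⟨f, hf, hW⟩ := Submodule.exists_le_ker_of_lt_top _ (lt_top_iff_ne_top.2 h)
  obtain ⟨y, hy⟩ : ∃ y, f y ≠ 0 := by
    by_contra! h0
    exact hf (LinearMap.ext h0)
  have hfψ : ∀ i, f (ψ i) = 0 := fun i => hW (Submodule.subset_span ⟨i, rfl⟩)
  refine ⟨f.smulRight ((f y)⁻¹ • y), ?_, ?_, ?_, fun i => Or.inr ?_⟩
  · ext x
    simp [hy]
  · intro h0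
    have := LinearMap.congr_fun h0 y
    simp only [LinearMap.smulRight_apply, smul_smul, mul_inv_cancel₀ hy, one_smul,
      LinearMap.zero_apply] at this
    exact hy (by simp [this])
  · intro h1
    have : Module.finrank ℂ V ≤ 1 := by
      refine finrank_le_one y fun x => ⟨f x * (f y)⁻¹, ?_⟩
      have := LinearMap.congr_fun h1 x
      simpa [smul_smul] using this
    omega
  · simp [hfψ]

/-- The `ψ i` are spanning eigenvectors, so each eigenspace is complemented by the sum of the others
and every `ψ i` lies in one of the two. Without a splitting, each eigenspace is zero or everything.
-/
theorem exists_eq_smul_one_of_not_decomposes [Nontrivial V] {ψ : K → V}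
    (hspan : Submodule.span ℂ (Set.range ψ) = ⊤) (h : ¬ Decomposes ψ) {T : V →ₗ[ℂ] V}
    (hT : ∀ i, ∃ c : ℂ, T (ψ i) = c • ψ i) : ∃ c : ℂ, T = c • 1 := by
  have hE : ∀ c : ℂ, Module.End.eigenspace T c = ⊥ ∨ Module.End.eigenspace T c = ⊤ := by
    intro c
    have hc : IsCompl (Module.End.eigenspace T c) (⨆ μ ≠ c, Module.End.eigenspace T μ) := by
      refine ⟨(Module.End.eigenspaces_iSupIndep T) c, codisjoint_iff.2 (top_le_iff.1 ?_)⟩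
      rw [← hspan, Submodule.span_le]
      rintro _ ⟨i, rfl⟩
      obtain ⟨μ, hμ⟩ := hT i
      have hμ' := Module.End.mem_eigenspace_iff.2 hμ
      by_cases hcμ : μ = c
      · exact Submodule.mem_sup_left (hcμ ▸ hμ')
      · exact Submodule.mem_sup_right (Submodule.mem_iSup_of_mem μ
          (Submodule.mem_iSup_of_mem hcμ hμ'))
    by_contra! hne
    refine h (decomposes_of_isCompl hc hne.1 hne.2 fun i => ?_)
    obtain ⟨μ, hμ⟩ := hT i
    have hμ' := Module.End.mem_eigenspace_iff.2 hμ
    by_cases hcμ : μ = c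
    · exact Or.inl (hcμ ▸ hμ')
    · exact Or.inr (Submodule.mem_iSup_of_mem μ (Submodule.mem_iSup_of_mem hcμ hμ'))
  obtain ⟨i, hi⟩ : ∃ i, ψ i ≠ 0 := by
    by_contra! h0
    refine bot_ne_top (α := Submodule ℂ V) ?_
    rw [← hspan, eq_comm, Submodule.span_eq_bot]
    rintro _ ⟨i, rfl⟩
    exact h0 i
  obtain ⟨c, hc⟩ := hT i
  rcases hE c with h0 | h1
  · exact absurd (h0 ▸ Module.End.mem_eigenspace_iff.2 hc) (by simpa using hi)
  · refine ⟨c, LinearMap.ext fun x => ?_⟩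
    have : x ∈ Module.End.eigenspace T c := h1 ▸ Submodule.mem_top
    simpa using Module.End.mem_eigenspace_iff.1 this

/-- One admissible `R` can be made nonzero on all `v i` simultaneously, hence invertible. For any
other admissible `R'`, the operator `R' R⁻¹` has every `ψ i` as an eigenvector, so it is scalar. -/
theorem totallyDetermines_span_singleton [FiniteDimensional ℂ V] [Nontrivial V] [Finite K]
    {ψ : K → V} (hspan : Submodule.span ℂ (Set.range ψ) = ⊤) (h : ¬ Decomposes ψ) :
    TotallyDetermines fun i => Submodule.span ℂ {ψ i} := by
  intro v hv
  let S : Submodule ℂ (V →ₗ[ℂ] V) :=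
    { carrier := {R | ∀ i, R (v i) ∈ Submodule.span ℂ {ψ i}}
      add_mem' := fun ha hb i => add_mem (ha i) (hb i)
      zero_mem' := fun i => zero_mem _
      smul_mem' := fun c R hR i => Submodule.smul_mem _ c (hR i) }
  have hg : ∀ i, ∃ f : Module.Dual ℂ (V →ₗ[ℂ] V), (∃ R ∈ S, f R ≠ 0) ∧
      ∀ R, f R ≠ 0 → R (v i) ≠ 0 := by
    intro i
    obtain ⟨R, hRi, hR⟩ := hv i
    obtain ⟨g, hg⟩ : ∃ g : Module.Dual ℂ V, g (R (v i)) ≠ 0 := by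
      by_contra! h0
      exact hRi ((Module.forall_dual_apply_eq_zero_iff ℂ _).1 h0)
    refine ⟨g ∘ₗ LinearMap.applyₗ (v i), ⟨R, hR, hg⟩, fun R' h' h0 => h' ?_⟩
    simp [h0]
  choose f hf hf' using hg
  -- Over an infinite field, finitely many functionals that are nonzero on `S` are all nonzero at a
  -- common point of `S`.
  obtain ⟨R, hRS, hR⟩ := Module.Dual.exists_forall_mem_ne_zero_of_forall_exists S f hf
  have hψ : ∀ i, ∃ c : ℂ, ψ i = R (c • v i) := by
    intro i
    obtain ⟨c, hc⟩ := Submodule.mem_span_singleton.1 (hRS i)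
    have hc0 : c ≠ 0 := by
      rintro rfl
      exact hf' i R (hR i) (by rw [← hc, zero_smul])
    exact ⟨c⁻¹, by rw [map_smul, ← hc, smul_smul, inv_mul_cancel₀ hc0, one_smul]⟩
  have hsurj : Function.Surjective R := by
    rw [← LinearMap.range_eq_top, ← top_le_iff, ← hspan, Submodule.span_le]
    rintro _ ⟨i, rfl⟩
    obtain ⟨c, hc⟩ := hψ i
    exact ⟨_, hc.symm⟩
  let e : V ≃ₗ[ℂ] V := LinearEquiv.ofBijective R ⟨LinearMap.injective_iff_surjective.2 hsurj, hsurj⟩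
  refine ⟨R, hRS, fun R' hR' => ?_⟩
  obtain ⟨c, hc⟩ := exists_eq_smul_one_of_not_decomposes hspan h
    (T := R' ∘ₗ e.symm.toLinearMap) fun i => by
      obtain ⟨c, hc⟩ := hψ i
      obtain ⟨b, hb⟩ := Submodule.mem_span_singleton.1 (hR' i)
      refine ⟨c * b, ?_⟩
      have : e.symm (ψ i) = c • v i := by
        rw [LinearEquiv.symm_apply_eq]
        exact hc
      rw [LinearMap.comp_apply, LinearEquiv.coe_coe, this, map_smul, ← hb, smul_smul]
  refine ⟨c, LinearMap.ext fun x => ?_⟩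
  have := LinearMap.congr_fun hc (e x)
  rw [LinearMap.comp_apply, LinearEquiv.coe_coe, e.symm_apply_apply] at this
  exact this

/-- For the vectors `v = ψ`, both the identity and the idempotent `π` are admissible, and they are
not proportional. -/
theorem not_totallyDetermines_span_singleton {ψ : K → V} (hψ : ∀ i, ψ i ≠ 0)
    (h : Decomposes ψ) : ¬ TotallyDetermines fun i => Submodule.span ℂ {ψ i} := by
  obtain ⟨π, hπ, h0, h1, hi⟩ := h
  intro hT
  obtain ⟨R, -, hR⟩ := hT ψ fun i => ⟨LinearMap.id, hψ i, fun j =>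
    Submodule.mem_span_singleton_self _⟩
  obtain ⟨a, ha⟩ := hR 1 fun i => Submodule.mem_span_singleton_self _
  obtain ⟨b, hb⟩ := hR π fun i => by
    rcases hi i with h | h <;> rw [h]
    · exact Submodule.mem_span_singleton_self _
    · exact zero_mem _
  have ha0 : a ≠ 0 := by
    rintro rfl
    rw [zero_smul] at ha
    exact h0 (by rw [← mul_one π, ha, mul_zero])
  have : π = (b * a⁻¹) • 1 := by
    rw [hb, ha, smul_smul, mul_assoc, inv_mul_cancel₀ ha0, mul_one]
  rcases eq_zero_or_eq_one_of_isIdempotentElem_smul hπ this with h | h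
  · exact h0 h
  · exact h1 h

end Decomposition

/-! ### Expectations, traces and rank-one operators -/

section Positivity

variable {H : Type*} [NormedAddCommGroup H] [InnerProductSpace ℂ H]

/-- The real part of `⟪x, T x⟫`. -/
noncomputable def expect (T : H →L[ℂ] H) (x : H) : ℝ := (inner ℂ x (T x)).re

theorem expect_add (S T : H →L[ℂ] H) (x : H) : expect (S + T) x = expect S x + expect T x := by
  simp [expect]

theorem expect_smul (c : ℝ) (T : H →L[ℂ] H) (x : H) :
    expect ((c : ℂ) • T) x = c * expect T x := by
  simp [expect]

theorem expect_sum {κ : Type*} (s : Finset κ) (T : κ → H →L[ℂ] H) (x : H) :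
    expect (∑ k ∈ s, T k) x = ∑ k ∈ s, expect (T k) x := by
  simp [expect]

theorem expect_one (x : H) : expect (1 : H →L[ℂ] H) x = ‖x‖ ^ 2 := by
  simp only [expect, one_apply_eq_self]
  exact (norm_sq_eq_re_inner (𝕜 := ℂ) x).symm

theorem expect_rankOne (w x : H) :
    expect (InnerProductSpace.rankOne ℂ w w) x = ‖inner ℂ w x‖ ^ 2 := by
  rw [expect, InnerProductSpace.rankOne_apply, inner_smul_right, ← inner_conj_symm x w,
    Complex.mul_conj, Complex.normSq_eq_norm_sq, Complex.ofReal_re]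

theorem expect_conj [CompleteSpace H] (R T : H →L[ℂ] H) (x : H) :
    expect (star R * T * R) x = expect T (R x) := by
  simp only [expect, mul_apply_eq_comp, ContinuousLinearMap.star_eq_adjoint,
    ContinuousLinearMap.adjoint_inner_right]

theorem expect_nonneg {T : H →L[ℂ] H} (hT : 0 ≤ T) (x : H) : 0 ≤ expect T x :=
  ((ContinuousLinearMap.nonneg_iff_isPositive T).1 hT).re_inner_nonneg_right x

theorem nonneg_of_expect_nonneg [CompleteSpace H] {T : H →L[ℂ] H} (hT : IsSelfAdjoint T)
    (h : ∀ x, 0 ≤ expect T x) : 0 ≤ T := by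
  rw [ContinuousLinearMap.nonneg_iff_isPositive, ContinuousLinearMap.isPositive_iff']
  refine ⟨hT, fun x => ?_⟩
  rw [RCLike.nonneg_iff]
  constructor
  · rw [inner_re_symm]
    exact h x
  · exact hT.isSymmetric.im_inner_apply_self x

theorem apply_eq_zero_of_expect_eq_zero [CompleteSpace H] {T : H →L[ℂ] H} (hT : 0 ≤ T) {x : H}
    (h : expect T x = 0) : T x = 0 := by
  obtain ⟨N, rfl⟩ := CStarAlgebra.nonneg_iff_eq_star_mul_self.1 hT
  have h1 : expect (star N * N) x = ‖N x‖ ^ 2 := by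
    rw [← mul_one (star N), expect_conj, expect_one]
  have h2 : N x = 0 := by
    rw [h1] at h
    simpa using h
  simp [h2]

variable [FiniteDimensional ℂ H]

theorem exists_eq_sum_rankOne {T : H →L[ℂ] H} (hT : 0 ≤ T) :
    ∃ (m : ℕ) (w : Fin m → H), T = ∑ j, InnerProductSpace.rankOne ℂ (w j) (w j) :=
  ContinuousLinearMap.isPositive_iff_eq_sum_rankOne.1
    ((ContinuousLinearMap.nonneg_iff_isPositive T).1 hT)

theorem exists_eq_rankOne_of_forall_eq_smul {m : ℕ} {w : Fin m → H} {u : H}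
    (h : ∀ j, ∃ c : ℂ, w j = c • u) :
    ∃ φ : H, ∑ j, InnerProductSpace.rankOne ℂ (w j) (w j) = InnerProductSpace.rankOne ℂ φ φ := by
  choose c hc using h
  refine ⟨((√(∑ j, ‖c j‖ ^ 2) : ℝ) : ℂ) • u, ContinuousLinearMap.ext fun x => ?_⟩
  have h1 : ((√(∑ j, ‖c j‖ ^ 2) : ℝ) : ℂ) * (√(∑ j, ‖c j‖ ^ 2) : ℝ) = ∑ j, (‖c j‖ : ℂ) ^ 2 := by
    rw [← Complex.ofReal_mul, Real.mul_self_sqrt (Finset.sum_nonneg fun _ _ => by positivity)]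
    push_cast
    rfl
  simp only [hc, sum_apply, InnerProductSpace.rankOne_apply, inner_smul_left, smul_smul,
    Complex.conj_ofReal]
  rw [mul_right_comm, h1, ← Finset.sum_smul, Finset.sum_mul]
  congr 1
  refine Finset.sum_congr rfl fun j _ => ?_
  rw [mul_right_comm, Complex.conj_mul' (c j)]

/-- The trace of an operator, as a real number. -/
noncomputable def reTrace (T : H →L[ℂ] H) : ℝ := (LinearMap.trace ℂ H T).re

theorem reTrace_sum {κ : Type*} (s : Finset κ) (T : κ → H →L[ℂ] H) :
    reTrace (∑ k ∈ s, T k) = ∑ k ∈ s, reTrace (T k) := by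
  have : ((∑ k ∈ s, T k : H →L[ℂ] H) : H →ₗ[ℂ] H) = ∑ k ∈ s, (T k : H →ₗ[ℂ] H) := by
    ext x; simp
  simp [reTrace, this]

theorem reTrace_rankOne (w : H) : reTrace (InnerProductSpace.rankOne ℂ w w) = ‖w‖ ^ 2 := by
  rw [reTrace, InnerProductSpace.trace_rankOne]
  exact (norm_sq_eq_re_inner (𝕜 := ℂ) w).symm

theorem expect_le_reTrace {T : H →L[ℂ] H} (hT : 0 ≤ T) (x : H) :
    expect T x ≤ reTrace T * ‖x‖ ^ 2 := by
  obtain ⟨m, w, rfl⟩ := exists_eq_sum_rankOne hT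
  rw [expect_sum, reTrace_sum, Finset.sum_mul]
  refine Finset.sum_le_sum fun j _ => ?_
  rw [expect_rankOne, reTrace_rankOne, ← mul_pow]
  gcongr
  exact norm_inner_le_norm _ _

theorem exists_eq_smul_of_expect_rankOne {φ x : H} (hφ : φ ≠ 0)
    (h : expect (InnerProductSpace.rankOne ℂ φ φ) x = ‖φ‖ ^ 2 * ‖x‖ ^ 2) :
    ∃ c : ℂ, x = c • φ := by
  rw [expect_rankOne, ← mul_pow, sq_eq_sq₀ (by positivity) (by positivity)] at h
  exact Or.resolve_left (((norm_inner_eq_norm_tfae ℂ φ x).out 0 2).1 h) hφ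

/-- Equality holds in Cauchy–Schwarz for each term of a rank-one expansion of `T`, so all its
vectors are multiples of `x`. -/
theorem exists_eq_rankOne_of_expect_eq_reTrace {T : H →L[ℂ] H} (hT : 0 ≤ T) {x : H} (hx : x ≠ 0)
    (h : expect T x = reTrace T * ‖x‖ ^ 2) : ∃ φ : H, T = InnerProductSpace.rankOne ℂ φ φ := by
  obtain ⟨m, w, rfl⟩ := exists_eq_sum_rankOne hT
  refine exists_eq_rankOne_of_forall_eq_smul (u := x) fun j => ?_
  rw [expect_sum, reTrace_sum, Finset.sum_mul, Finset.sum_eq_sum_iff_of_le] at h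
  · have := h j (Finset.mem_univ j)
    rw [expect_rankOne, reTrace_rankOne, ← mul_pow, sq_eq_sq₀ (by positivity) (by positivity),
      norm_inner_symm, mul_comm] at this
    exact Or.resolve_left (((norm_inner_eq_norm_tfae ℂ x (w j)).out 0 2).1 this) hx
  · intro j _
    rw [expect_rankOne, reTrace_rankOne, ← mul_pow]
    gcongr
    exact norm_inner_le_norm _ _

theorem exists_eq_rankOne_of_opRank_eq_one {T : H →L[ℂ] H} (hT : 0 ≤ T) (h : opRank T = 1) :
    ∃ φ : H, φ ≠ 0 ∧ T = InnerProductSpace.rankOne ℂ φ φ := by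
  have hT0 : T ≠ 0 := by
    rintro rfl
    rw [opRank, ContinuousLinearMap.toLinearMap_zero, LinearMap.range_zero, finrank_bot] at h
    exact zero_ne_one h
  obtain ⟨u, hu, hu'⟩ := finrank_eq_one_iff'.1 h
  obtain ⟨m, w, hw⟩ := exists_eq_sum_rankOne hT
  have key : ∀ j, ∃ c : ℂ, w j = c • (u : H) := by
    intro j
    -- If `x` is orthogonal to the range of `T`, then `⟪x, T x⟫ = 0`, and each nonnegative term of
    -- the expansion vanishes at `x`.
    have : w j ∈ (Submodule.span ℂ {(u : H)})ᗮᗮ := by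
      rw [Submodule.mem_orthogonal]
      intro x hx
      have hx' := Submodule.mem_orthogonal_singleton_iff_inner_right.1 hx
      obtain ⟨c, hc⟩ := hu' ⟨T x, LinearMap.mem_range_self _ x⟩
      have hc' : T x = c • (u : H) := by
        rw [← Submodule.coe_smul, hc]
      have h0 : expect T x = 0 := by
        rw [expect, hc', inner_smul_right, ← inner_conj_symm, hx']
        simp
      rw [hw, expect_sum, Finset.sum_eq_zero_iff_of_nonneg] at h0
      · have := h0 j (Finset.mem_univ j)
        rw [expect_rankOne] at this
        exact inner_eq_zero_symm.1 (by simpa using this)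
      · intro j _
        rw [expect_rankOne]
        positivity
    rw [Submodule.orthogonal_orthogonal] at this
    obtain ⟨c, hc⟩ := Submodule.mem_span_singleton.1 this
    exact ⟨c, hc.symm⟩
  obtain ⟨φ, hφ⟩ := exists_eq_rankOne_of_forall_eq_smul key
  rw [← hw] at hφ
  refine ⟨φ, ?_, hφ⟩
  rintro rfl
  exact hT0 (by simpa using hφ)

theorem supp_smul_rankOne {a : ℂ} (ha : a ≠ 0) (ψ : H) :
    supp (a • InnerProductSpace.rankOne ℂ ψ ψ) = Submodule.span ℂ {ψ} := by
  have h : {φ : H | inner ℂ φ ((a • InnerProductSpace.rankOne ℂ ψ ψ) φ) = 0} =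
      ((Submodule.span ℂ {ψ})ᗮ : Submodule ℂ H) := by
    ext φ
    rw [SetLike.mem_coe, Submodule.mem_orthogonal_singleton_iff_inner_right, Set.mem_ofPred_eq,
      smul_apply, InnerProductSpace.rankOne_apply, inner_smul_right, inner_smul_right,
      ← inner_conj_symm φ ψ, Complex.mul_conj]
    simp [ha]
  rw [supp, h, Submodule.span_eq, Submodule.orthogonal_orthogonal]

end Positivity

theorem mul_eq_one_symm {H : Type*} [NormedAddCommGroup H] [InnerProductSpace ℂ H]
    [FiniteDimensional ℂ H] {A B : H →L[ℂ] H} (h : A * B = 1) : B * A = 1 := by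
  have h1 : (A : H →ₗ[ℂ] H) * (B : H →ₗ[ℂ] H) = 1 :=
    LinearMap.ext fun x => DFunLike.congr_fun h x
  exact ContinuousLinearMap.ext fun x => LinearMap.congr_fun (mul_eq_one_comm.1 h1) x

/-! ### The condition (*) forces unitary equivalence -/

namespace POVM

variable {ι H : Type*} [Fintype ι] [NormedAddCommGroup H] [InnerProductSpace ℂ H]

theorem elem_nonneg (P : POVM ι H) (i : ι) : 0 ≤ P.elem i :=
  (ContinuousLinearMap.nonneg_iff_isPositive _).2 (P.nonneg i)

theorem sum_expect (P : POVM ι H) (x : H) : ∑ i, expect (P.elem i) x = ‖x‖ ^ 2 := by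
  rw [← expect_sum, P.sum_eq_one, expect_one]

variable [CompleteSpace H]

theorem UnitaryEquiv.symm {P Q : POVM ι H} (h : P.UnitaryEquiv Q) : Q.UnitaryEquiv P := by
  obtain ⟨U, hU, h⟩ := h
  refine ⟨star U, Unitary.star_mem hU, fun i => ?_⟩
  rw [← h i, star_star, ← mul_assoc, ← mul_assoc, Unitary.star_mul_self_of_mem hU, one_mul,
    mul_assoc, Unitary.star_mul_self_of_mem hU, mul_one]

theorem UnitaryEquiv.cleaner {P Q : POVM ι H} (h : P.UnitaryEquiv Q) : P.Cleaner Q := by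
  obtain ⟨U, hU, h⟩ := h
  refine ⟨krausChannel (fun _ : Unit => star U) ?_, fun i => ?_⟩
  · simpa using Unitary.mul_star_self_of_mem hU
  · rw [krausChannel_apply, ← h i]
    simp

theorem UnitaryEquiv.cleanEquiv {P Q : POVM ι H} (h : P.UnitaryEquiv Q) : P.CleanEquiv Q :=
  ⟨h.symm.cleaner, h.cleaner⟩

variable [FiniteDimensional ℂ H]

theorem Cleaner.exists_kraus {P Q : POVM ι H} (h : P.Cleaner Q) :
    ∃ (κ : Type) (_ : Fintype κ) (R : κ → H →L[ℂ] H), (∑ k, star (R k) * R k = 1) ∧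
      ∀ i, ∑ k, star (R k) * P.elem i * R k = Q.elem i := by
  obtain ⟨E, hE⟩ := h
  obtain ⟨κ, _, R, hR⟩ := CleanPOVM.exists_kraus E.toCP
  refine ⟨κ, inferInstance, R, ?_, fun i => by rw [← hR, hE]⟩
  rw [← E.map_one, hR]
  simp

theorem exists_rankOne (P : POVM ι H) {i : ι} (h : P.RankOneAt i) :
    ∃ φ : H, φ ≠ 0 ∧ P.elem i = InnerProductSpace.rankOne ℂ φ φ :=
  exists_eq_rankOne_of_opRank_eq_one (P.elem_nonneg i) h

theorem unitaryEquiv_of_rankOneSupportsDetermine [Nontrivial H] {P Q : POVM ι H}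
    (hP : P.RankOneSupportsDetermine) (h : Q.Cleaner P) : P.UnitaryEquiv Q := by
  obtain ⟨κ, _, R, hR1, hR⟩ := h.exists_kraus
  -- A vector where `P i` has zero expectation is sent by `R k` into the kernel of `Q i`; the claim
  -- is the adjoint of this.
  have hsupp : ∀ i k y, star (R k) (Q.elem i y) ∈ supp (P.elem i) := by
    intro i k y
    have hker : ∀ φ : H, inner ℂ φ (P.elem i φ) = 0 → Q.elem i (R k φ) = 0 := by
      intro φ hφ
      have h0 : expect (P.elem i) φ = 0 := by rw [expect, hφ, Complex.zero_re]
      rw [← hR i, expect_sum, Finset.sum_eq_zero_iff_of_nonneg] at h0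
      · have := h0 k (Finset.mem_univ k)
        rw [expect_conj] at this
        exact apply_eq_zero_of_expect_eq_zero (Q.elem_nonneg i) this
      · intro l _
        rw [expect_conj]
        exact expect_nonneg (Q.elem_nonneg i) _
    have hle : Submodule.span ℂ {φ : H | inner ℂ φ (P.elem i φ) = 0} ≤
        LinearMap.ker ((Q.elem i * R k : H →L[ℂ] H) : H →ₗ[ℂ] H) :=
      Submodule.span_le.2 fun φ hφ => hker φ hφ
    rw [supp, Submodule.mem_orthogonal]
    intro φ hφ
    have h1 : Q.elem i (R k φ) = 0 := hle hφ
    rw [ContinuousLinearMap.star_eq_adjoint, ContinuousLinearMap.adjoint_inner_right,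
      ← (Q.nonneg i).inner_left_eq_inner_right, h1, inner_zero_left]
  -- A vector in the range of `Q i` not killed by all `star (R k)` exists, since otherwise `P i`
  -- would vanish.
  have hv : ∀ i : {i // P.RankOneAt i}, ∃ v : H, (∃ y, v = Q.elem i y) ∧
      ∃ k, star (R k) v ≠ 0 := by
    intro i
    by_contra! h0
    obtain ⟨φ, hφ, hφ'⟩ := P.exists_rankOne i.2
    have : P.elem i = 0 := by
      rw [← hR]
      refine Finset.sum_eq_zero fun k _ => ContinuousLinearMap.ext fun x => ?_
      exact h0 _ ⟨R k x, rfl⟩ k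
    rw [hφ', InnerProductSpace.rankOne_eq_zero] at this
    exact hφ (this.elim id id)
  choose v hvQ hv0 using hv
  have hvF : ∀ (i : {i // P.RankOneAt i}) k, star (R k) (v i) ∈ supp (P.elem i) := by
    intro i k
    obtain ⟨y, hy⟩ := hvQ i
    rw [hy]
    exact hsupp i k y
  obtain ⟨R₀, -, hR₀⟩ := hP v fun i => by
    obtain ⟨k, hk⟩ := hv0 i
    exact ⟨(star (R k) : H →L[ℂ] H), hk, fun j => hvF j k⟩
  have hc : ∀ k, ∃ c : ℂ, ((star (R k) : H →L[ℂ] H) : H →ₗ[ℂ] H) = c • R₀ :=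
    fun k => hR₀ _ fun j => hvF j k
  choose c hc using hc
  let W : H →L[ℂ] H := LinearMap.toContinuousLinearMap R₀
  have hW : ∀ k, star (R k) = c k • W := fun k =>
    ContinuousLinearMap.ext fun x => LinearMap.congr_fun (hc k) x
  have hW' : ∀ k, R k = star (c k) • star W := fun k => by
    rw [← star_star (R k), hW, star_smul]
  have hconj : ∀ X : H →L[ℂ] H, ∑ k, star (R k) * X * R k =
      ((∑ k, ‖c k‖ ^ 2 : ℝ) : ℂ) • (W * X * star W) := by
    intro X
    push_cast
    rw [Finset.sum_smul]
    refine Finset.sum_congr rfl fun k _ => ?_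
    rw [hW, hW', smul_mul_assoc, smul_mul_assoc, mul_smul_comm, smul_smul]
    congr 1
    exact Complex.mul_conj' _
  set s : ℝ := ∑ k, ‖c k‖ ^ 2
  have hs : 0 ≤ s := Finset.sum_nonneg fun _ _ => by positivity
  have hss : ((√s : ℝ) : ℂ) * (√s : ℝ) = s := by
    rw [← Complex.ofReal_mul, Real.mul_self_sqrt hs]
  have hU : ∀ X : H →L[ℂ] H, (((√s : ℝ) : ℂ) • W) * X * star (((√s : ℝ) : ℂ) • W) =
      ∑ k, star (R k) * X * R k := by
    intro X
    rw [hconj, star_smul, smul_mul_assoc, smul_mul_assoc, mul_smul_comm, smul_smul]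
    congr 1
    rw [← hss]
    congr 1
    exact Complex.conj_ofReal _
  have hU1 : (((√s : ℝ) : ℂ) • W) * star (((√s : ℝ) : ℂ) • W) = 1 := by
    have := hU 1
    rw [mul_one] at this
    rw [this]
    simpa using hR1
  refine UnitaryEquiv.symm ⟨((√s : ℝ) : ℂ) • W, ?_, fun i => by rw [hU, hR]⟩
  exact Unitary.mem_iff.2 ⟨mul_eq_one_symm hU1, hU1⟩

/-- Two families with the same Gram matrix, the first one being a tight frame, are related by a
unitary. -/
theorem _root_.CleanPOVM.exists_unitary_of_inner_eq {ψ u : ι → H}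
    (h1 : ∑ i, InnerProductSpace.rankOne ℂ (ψ i) (ψ i) = 1)
    (h : ∀ i j, inner ℂ (u i) (u j) = inner ℂ (ψ i) (ψ j)) :
    ∃ U ∈ unitary (H →L[ℂ] H), ∀ i, U (ψ i) = u i := by
  have hψ : ∀ x, ∑ i, inner ℂ (ψ i) x • ψ i = x := by
    intro x
    have := DFunLike.congr_fun h1 x
    simpa [sum_apply] using this
  set U : H →L[ℂ] H := ∑ i, InnerProductSpace.rankOne ℂ (u i) (ψ i)
  have hUx : ∀ x, U x = ∑ i, inner ℂ (ψ i) x • u i := fun x => by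
    simp [U, sum_apply]
  have hin : ∀ x y, inner ℂ (U x) (U y) = inner ℂ x y := by
    intro x y
    conv_rhs => rw [← hψ x, ← hψ y]
    simp only [hUx, sum_inner, inner_sum, inner_smul_left, inner_smul_right, h]
  have hU : star U * U = 1 := by
    ext x
    refine ext_inner_left ℂ fun y => ?_
    rw [mul_apply_eq_comp, ContinuousLinearMap.star_eq_adjoint,
      ContinuousLinearMap.adjoint_inner_right, hin, one_apply_eq_self]
  refine ⟨U, Unitary.mem_iff.2 ⟨hU, mul_eq_one_symm hU⟩, fun i => ?_⟩
  rw [← sub_eq_zero, ← inner_self_eq_zero (𝕜 := ℂ)]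
  have hui : ∀ j, inner ℂ (u j) (U (ψ i)) = inner ℂ (ψ j) (ψ i) := by
    intro j
    conv_rhs => rw [← hψ (ψ i)]
    simp only [hUx, inner_sum, inner_smul_right, h]
  have h2 : inner ℂ (U (ψ i)) (u i) = inner ℂ (ψ i) (ψ i) := by
    rw [← inner_conj_symm, hui, inner_conj_symm]
  rw [inner_sub_left, inner_sub_right, inner_sub_right, hin, hui, h2, h]
  ring

/-- A quantum pre-processing of a POVM into a rank-one POVM maps unnormalized pure states to pure
states: the elements of the source are `|φ i⟩⟨φ i|`, and the Kraus operators send the vectors of the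
target to multiples of the `φ i`. -/
theorem exists_rankOne_of_kraus {P Q : POVM ι H} {κ : Type*} [Fintype κ] {R : κ → H →L[ℂ] H}
    (hR1 : ∑ k, star (R k) * R k = 1) (hR : ∀ i, ∑ k, star (R k) * Q.elem i * R k = P.elem i)
    {ψ : ι → H} (hψ0 : ∀ i, ψ i ≠ 0) (hψ : ∀ i, P.elem i = InnerProductSpace.rankOne ℂ (ψ i) (ψ i))
    (i : ι) : ∃ φ : H, ‖φ‖ = ‖ψ i‖ ∧ Q.elem i = InnerProductSpace.rankOne ℂ φ φ ∧
      ∀ k, ∃ c : ℂ, R k (ψ i) = c • φ := by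
  have hnorm : ∀ x, ∑ k, ‖R k x‖ ^ 2 = ‖x‖ ^ 2 := by
    intro x
    rw [← expect_one, ← hR1, expect_sum]
    refine Finset.sum_congr rfl fun k _ => ?_
    rw [← mul_one (star (R k)), expect_conj, expect_one]
  have hexp : ∀ i x, ∑ k, expect (Q.elem i) (R k x) = ‖inner ℂ (ψ i) x‖ ^ 2 := by
    intro i x
    rw [← expect_rankOne, ← hψ, ← hR, expect_sum]
    simp only [expect_conj]
  have hle : ∀ i k x, expect (Q.elem i) (R k x) ≤ reTrace (Q.elem i) * ‖R k x‖ ^ 2 :=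
    fun i k x => expect_le_reTrace (Q.elem_nonneg i) _
  have hψψ : ∀ i, ‖inner ℂ (ψ i) (ψ i)‖ ^ 2 = ‖ψ i‖ ^ 2 * ‖ψ i‖ ^ 2 := fun i => by
    rw [inner_self_eq_norm_sq_to_K]
    norm_num
    ring
  have htr : ∀ i ∈ Finset.univ, ‖ψ i‖ ^ 2 ≤ reTrace (Q.elem i) := by
    intro i _
    have h1 := Finset.sum_le_sum fun k (_ : k ∈ Finset.univ) => hle i k (ψ i)
    rw [hexp, ← Finset.mul_sum, hnorm, hψψ] at h1
    have : 0 < ‖ψ i‖ ^ 2 := by have := norm_pos_iff.2 (hψ0 i); positivity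
    -- The bound comes from `‖ψ i‖ ^ 4 = ∑ k, expect (Q i) (R k (ψ i)) ≤ reTrace (Q i) * ‖ψ i‖ ^ 2`.
    exact le_of_mul_le_mul_right h1 this
  have htr' : ∀ i, ‖ψ i‖ ^ 2 = reTrace (Q.elem i) := by
    intro i
    -- Both sides sum over `i` to the trace of the identity, so each inequality is an equality.
    refine (Finset.sum_eq_sum_iff_of_le htr).1 ?_ i (Finset.mem_univ i)
    rw [← reTrace_sum, Q.sum_eq_one, ← P.sum_eq_one, reTrace_sum]
    simp only [hψ, reTrace_rankOne]
  have heq : ∀ k, expect (Q.elem i) (R k (ψ i)) = reTrace (Q.elem i) * ‖R k (ψ i)‖ ^ 2 := by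
    intro k
    refine (Finset.sum_eq_sum_iff_of_le fun k _ => hle i k (ψ i)).1 ?_ k (Finset.mem_univ k)
    rw [hexp, ← Finset.mul_sum, hnorm, hψψ, htr' i]
  obtain ⟨k, hk⟩ : ∃ k, R k (ψ i) ≠ 0 := by
    by_contra! h0
    have := hnorm (ψ i)
    simp only [h0, norm_zero] at this
    exact hψ0 i (by simpa using this.symm)
  obtain ⟨φ, hφ⟩ := exists_eq_rankOne_of_expect_eq_reTrace (Q.elem_nonneg i) hk (heq k)
  have hnφ : ‖φ‖ = ‖ψ i‖ := by
    rw [← sq_eq_sq₀ (norm_nonneg _) (norm_nonneg _), htr', hφ, reTrace_rankOne]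
  refine ⟨φ, hnφ, hφ, fun l => exists_eq_smul_of_expect_rankOne ?_ ?_⟩
  · rw [← norm_ne_zero_iff, hnφ]
    simpa using hψ0 i
  · rw [← hφ, heq, ← htr', hnφ]

/-- With `R k (ψ i) = d i k • φ i`, the Gram matrix of `ψ` is the entrywise product of those of `d`
and `φ`. The vectors `d i` are shown to contribute only phases, which can be absorbed into the `φ
i`. -/
theorem unitaryEquiv_of_isRankOne {P Q : POVM ι H} (hP : P.IsRankOne) (h : Q.Cleaner P) :
    P.UnitaryEquiv Q := by
  obtain ⟨κ, _, R, hR1, hR⟩ := h.exists_kraus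
  choose ψ hψ0 hψ using fun i => P.exists_rankOne (hP i)
  choose φ hφn hφ d hd using exists_rankOne_of_kraus hR1 hR hψ0 hψ
  have hin : ∀ i j, inner ℂ (ψ i) (ψ j) =
      inner ℂ (WithLp.toLp 2 (d i)) (WithLp.toLp 2 (d j)) * inner ℂ (φ i) (φ j) := by
    intro i j
    calc inner ℂ (ψ i) (ψ j) = inner ℂ (ψ i) ((∑ k, star (R k) * R k : H →L[ℂ] H) (ψ j)) := by
          rw [hR1, one_apply_eq_self]
      _ = ∑ k, inner ℂ (R k (ψ i)) (R k (ψ j)) := by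
          simp [sum_apply, ContinuousLinearMap.star_eq_adjoint,
            ContinuousLinearMap.adjoint_inner_right]
      _ = _ := by
          rw [PiLp.inner_apply, Finset.sum_mul]
          refine Finset.sum_congr rfl fun k _ => ?_
          rw [hd, hd, inner_smul_left, inner_smul_right, RCLike.inner_apply]
          ring
  have hφ0 : ∀ i, ‖φ i‖ ≠ 0 := fun i => by
    rw [hφn]
    simpa using hψ0 i
  have hd1 : ∀ i, ‖WithLp.toLp 2 (d i)‖ = 1 := by
    intro i
    have h1 := hin i i
    rw [inner_self_eq_norm_sq_to_K, inner_self_eq_norm_sq_to_K, inner_self_eq_norm_sq_to_K,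
      ← hφn] at h1
    have h2 : ‖WithLp.toLp 2 (d i)‖ ^ 2 = 1 := by
      have h3 : ‖φ i‖ ^ 2 = ‖WithLp.toLp 2 (d i)‖ ^ 2 * ‖φ i‖ ^ 2 := by exact_mod_cast h1
      have h4 : ‖φ i‖ ^ 2 ≠ 0 := pow_ne_zero _ (hφ0 i)
      exact mul_right_cancel₀ h4 (by rw [one_mul]; exact h3.symm)
    exact (pow_eq_one_iff_of_nonneg (norm_nonneg _) two_ne_zero).1 h2
  have hle : ∀ i j, ‖inner ℂ (ψ i) (ψ j)‖ ^ 2 ≤ ‖inner ℂ (φ i) (φ j)‖ ^ 2 := by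
    intro i j
    have := norm_inner_le_norm (𝕜 := ℂ) (WithLp.toLp 2 (d i)) (WithLp.toLp 2 (d j))
    rw [hd1, hd1, one_mul] at this
    rw [hin, norm_mul]
    have h0 := norm_nonneg (inner ℂ (φ i) (φ j))
    gcongr
    exact mul_le_of_le_one_left h0 this
  have heq : ∀ i j, ‖inner ℂ (ψ i) (ψ j)‖ ^ 2 = ‖inner ℂ (φ i) (φ j)‖ ^ 2 := by
    intro i j
    rw [norm_inner_symm (ψ i), norm_inner_symm (φ i)]
    -- Since both families resolve the identity, the two sums over `j` are `‖ψ i‖ ^ 2` and `‖φ i‖ ^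
    -- 2`, which agree.
    refine (Finset.sum_eq_sum_iff_of_le fun j _ => hle j i).1 ?_ j (Finset.mem_univ j)
    have h1 := P.sum_expect (ψ i)
    have h2 := Q.sum_expect (φ i)
    simp only [hψ, hφ, expect_rankOne] at h1 h2
    rw [h1, h2, hφn]
  -- Where `φ i` and `φ j` are not orthogonal, `d i` and `d j` differ by a phase. A functional
  -- nonzero on every `d i` reads off these phases consistently for all pairs.
  obtain ⟨f, hf⟩ := Module.exists_dual_forall_apply_ne_zero (K := ℂ)
    (fun i => WithLp.toLp 2 (d i)) fun i => by
      rw [← norm_ne_zero_iff, hd1]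
      exact one_ne_zero
  set s : ι → ℂ := fun i => f (WithLp.toLp 2 (d i))
  have hs0 : ∀ i, (‖s i‖ : ℂ) ≠ 0 := fun i => by simpa using hf i
  have hgram : ∀ i j, inner ℂ ((s i / ‖s i‖) • φ i) ((s j / ‖s j‖) • φ j) =
      inner ℂ (ψ i) (ψ j) := by
    intro i j
    rw [hin, inner_smul_left, inner_smul_right, ← mul_assoc]
    by_cases h0 : inner ℂ (φ i) (φ j) = 0
    · rw [h0, mul_zero, mul_zero]
    congr 1
    have h1 : ‖inner ℂ (WithLp.toLp 2 (d i)) (WithLp.toLp 2 (d j))‖ = 1 := by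
      have h2 := (sq_eq_sq₀ (norm_nonneg _) (norm_nonneg _)).1 (heq i j)
      rw [hin, norm_mul] at h2
      exact mul_right_cancel₀ (norm_ne_zero_iff.2 h0) (by rw [one_mul]; exact h2)
    have h2 : ‖inner ℂ (WithLp.toLp 2 (d i)) (WithLp.toLp 2 (d j))‖ =
        ‖WithLp.toLp 2 (d i)‖ * ‖WithLp.toLp 2 (d j)‖ := by
      rw [h1, hd1, hd1, one_mul]
    obtain ⟨a, ha⟩ := Or.resolve_left (((norm_inner_eq_norm_tfae ℂ _ _).out 0 2).1 h2)
      (norm_ne_zero_iff.1 (by rw [hd1]; exact one_ne_zero))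
    have hin' : inner ℂ (WithLp.toLp 2 (d i)) (WithLp.toLp 2 (d j)) = a := by
      rw [ha, inner_smul_right, inner_self_eq_norm_sq_to_K, hd1]
      simp
    have ha1 : ‖a‖ = 1 := by rw [← hin', h1]
    have hsj : s j = a * s i := by
      simp only [s, ha, map_smul, smul_eq_mul]
    rw [hin', hsj, norm_mul, ha1, one_mul, map_div₀, Complex.conj_ofReal, div_mul_div_comm,
      div_eq_iff (mul_ne_zero (hs0 i) (hs0 i)), mul_left_comm, Complex.conj_mul']
    ring
  obtain ⟨U, hU, hUψ⟩ := exists_unitary_of_inner_eq (ψ := ψ)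
    (u := fun i => (s i / ‖s i‖) • φ i) (by simp only [← hψ, P.sum_eq_one]) hgram
  refine ⟨U, hU, fun i => ContinuousLinearMap.ext fun x => ?_⟩
  rw [hψ, hφ, mul_apply_eq_comp, mul_apply_eq_comp, InnerProductSpace.rankOne_apply, map_smul, hUψ,
    ContinuousLinearMap.star_eq_adjoint, ContinuousLinearMap.adjoint_inner_right, hUψ,
    InnerProductSpace.rankOne_apply, inner_smul_left, smul_smul, mul_right_comm, map_div₀,
    Complex.conj_ofReal, div_mul_div_comm, Complex.conj_mul', sq,
    div_self (mul_ne_zero (hs0 i) (hs0 i)), one_mul]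

end POVM

/-! ### Perturbation of clean POVMs -/

section Perturbation

variable {H : Type*} [NormedAddCommGroup H] [InnerProductSpace ℂ H] [CompleteSpace H]
  [FiniteDimensional ℂ H]

theorem exists_invertible_factor {Y : H →L[ℂ] H} (hY : 0 ≤ Y) (h : ∀ x, Y x = 0 → x = 0) :
    ∃ N B : H →L[ℂ] H, Y = star N * N ∧ B * N = 1 ∧ N * B = 1 := by
  obtain ⟨N, rfl⟩ := CStarAlgebra.nonneg_iff_eq_star_mul_self.1 hY
  have hinj : Function.Injective N := by
    rw [injective_iff_map_eq_zero]
    intro x hx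
    exact h x (by simp [hx])
  let e : H ≃ₗ[ℂ] H := LinearEquiv.ofBijective (N : H →ₗ[ℂ] H)
    ⟨hinj, LinearMap.injective_iff_surjective.1 hinj⟩
  let B : H →L[ℂ] H := LinearMap.toContinuousLinearMap (e.symm : H →ₗ[ℂ] H)
  have hB : B * N = 1 := ContinuousLinearMap.ext fun x => e.symm_apply_apply x
  exact ⟨N, B, rfl, hB, mul_eq_one_symm hB⟩

theorem exists_pos_mul_norm_sq_le_expect {Y : H →L[ℂ] H} (hY : 0 ≤ Y)
    (h : ∀ x, Y x = 0 → x = 0) : ∃ c > 0, ∀ x, c * ‖x‖ ^ 2 ≤ expect Y x := by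
  obtain ⟨N, B, rfl, hB, -⟩ := exists_invertible_factor hY h
  refine ⟨1 / (‖B‖ ^ 2 + 1), by positivity, fun x => ?_⟩
  have hx : B (N x) = x := DFunLike.congr_fun hB x
  rw [← mul_one (star N), expect_conj, expect_one, one_div_mul_eq_div,
    div_le_iff₀ (by positivity)]
  calc ‖x‖ ^ 2 = ‖B (N x)‖ ^ 2 := by rw [hx]
    _ ≤ (‖B‖ * ‖N x‖) ^ 2 := by gcongr; exact B.le_opNorm _
    _ ≤ ‖N x‖ ^ 2 * (‖B‖ ^ 2 + 1) := by nlinarith [sq_nonneg ‖N x‖]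

theorem exists_pos_mul_norm_sq_le_expect_of_opRank {Y : H →L[ℂ] H} (hY : 0 ≤ Y)
    (h : opRank Y = Module.finrank ℂ H) : ∃ c > 0, ∀ x, c * ‖x‖ ^ 2 ≤ expect Y x := by
  refine exists_pos_mul_norm_sq_le_expect hY ?_
  have hr : LinearMap.range (Y : H →ₗ[ℂ] H) = ⊤ := Submodule.eq_top_of_finrank_eq h
  have hinj := LinearMap.injective_iff_surjective.2 (LinearMap.range_eq_top.1 hr)
  exact fun x hx => (injective_iff_map_eq_zero (Y : H →ₗ[ℂ] H)).1 hinj x hx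

theorem abs_expect_le (T : H →L[ℂ] H) (x : H) : |expect T x| ≤ ‖T‖ * ‖x‖ ^ 2 := by
  calc |expect T x| ≤ ‖inner ℂ x (T x)‖ := Complex.abs_re_le_norm _
    _ ≤ ‖x‖ * ‖T x‖ := norm_inner_le_norm _ _
    _ ≤ ‖x‖ * (‖T‖ * ‖x‖) := by gcongr; exact T.le_opNorm _
    _ = _ := by ring

/-- The map `X ↦ a X + b (π X π* + σ X σ*)` has a Kraus form. -/
theorem exists_kraus_pinching (π σ : H →L[ℂ] H) {a b : ℝ} (ha : 0 ≤ a) (hb : 0 ≤ b) :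
    ∃ D : Fin 3 → H →L[ℂ] H, ∀ X, ∑ k, star (D k) * X * D k =
      (a : ℂ) • X + (b : ℂ) • (π * X * star π + σ * X * star σ) := by
  have hs : ∀ {c : ℝ}, 0 ≤ c → ∀ T X : H →L[ℂ] H,
      star (((√c : ℝ) : ℂ) • star T) * X * (((√c : ℝ) : ℂ) • star T) =
        (c : ℂ) • (T * X * star T) := by
    intro c hc T X
    rw [star_smul, star_star, smul_mul_assoc, smul_mul_assoc, mul_smul_comm, smul_smul]
    congr 1
    calc star ((√c : ℝ) : ℂ) * (√c : ℝ) = (√c : ℝ) * (√c : ℝ) := by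
          congr 1
          exact Complex.conj_ofReal _
      _ = c := by rw [← Complex.ofReal_mul, Real.mul_self_sqrt hc]
  refine ⟨![((√a : ℝ) : ℂ) • star 1, ((√b : ℝ) : ℂ) • star π, ((√b : ℝ) : ℂ) • star σ],
    fun X => ?_⟩
  simp only [Fin.sum_univ_three, Matrix.cons_val]
  rw [hs ha, hs hb, hs hb, smul_add, ← add_assoc, star_one, one_mul, mul_one]

end Perturbation

namespace POVM

variable {ι H : Type*} [Fintype ι] [NormedAddCommGroup H] [InnerProductSpace ℂ H] [CompleteSpace H]
  [FiniteDimensional ℂ H]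

/-- If `D` is a Kraus family mapping the positive operators `S i` to a clean POVM, then each `S i`
dominates the sum of all `S j` with the factor with which its image dominates the identity. -/
theorem IsClean.mul_sum_expect_le {P : POVM ι H} (hP : P.IsClean) {S : ι → H →L[ℂ] H}
    (hS : ∀ i, 0 ≤ S i) (hinj : ∀ x, (∀ i, S i x = 0) → x = 0) {κ : Type*} [Fintype κ]
    {D : κ → H →L[ℂ] H} (hD : ∀ i, ∑ k, star (D k) * S i * D k = P.elem i) {i : ι} {m : ℝ}
    (hm : ∀ x, m * ‖x‖ ^ 2 ≤ expect (P.elem i) x) (x : H) :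
    m * ∑ j, expect (S j) x ≤ expect (S i) x := by
  obtain ⟨N, B, hN, hBN, hNB⟩ := exists_invertible_factor (Y := ∑ j, S j)
    (Finset.sum_nonneg fun j _ => hS j) fun x hx => hinj x fun j => by
      have h0 : expect (∑ j, S j) x = 0 := by rw [expect, hx, inner_zero_right, Complex.zero_re]
      rw [expect_sum, Finset.sum_eq_zero_iff_of_nonneg fun j _ => expect_nonneg (hS j) x] at h0
      exact apply_eq_zero_of_expect_eq_zero (hS j) (h0 j (Finset.mem_univ j))
  have hBN' : star N * star B = 1 := by rw [← star_mul, hBN, star_one]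
  have hNB' : star B * star N = 1 := by rw [← star_mul, hNB, star_one]
  -- Conjugating by `B = N⁻¹` normalizes the `S j`, whose sum is `star N * N`. The Kraus family `N *
  -- D k` then sends `Q` to `P`.
  let Q : POVM ι H :=
    { elem := fun j => star B * S j * B
      nonneg := fun j => (ContinuousLinearMap.nonneg_iff_isPositive _).1
        (star_left_conjugate_nonneg (hS j) B)
      sum_eq_one := by
        rw [← Finset.sum_mul, ← Finset.mul_sum, hN, ← mul_assoc, hNB', one_mul, hNB] }
  have hNQ : ∀ j, star N * (star B * S j * B) * N = S j := by
    intro j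
    rw [← mul_assoc, ← mul_assoc, hBN', one_mul, mul_assoc, hBN, mul_one]
  have hQP : Q.Cleaner P := by
    refine ⟨krausChannel (fun k => N * D k) ?_, fun j => ?_⟩
    · rw [← P.sum_eq_one, ← Finset.sum_congr rfl fun j _ => hD j, Finset.sum_comm]
      refine Finset.sum_congr rfl fun k _ => ?_
      rw [← Finset.sum_mul, ← Finset.mul_sum, hN, star_mul]
      simp only [mul_assoc]
    · rw [krausChannel_apply, ← hD]
      refine Finset.sum_congr rfl fun k _ => ?_
      conv_rhs => rw [← hNQ j]
      rw [star_mul]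
      simp only [mul_assoc, Q]
  -- Cleanness gives a channel from `P` back to `Q`; channels preserve order and identity, so the
  -- lower bound `m` passes to `Q i`, and conjugation by `N` carries it to `S i`.
  obtain ⟨κ', _, R, hR1, hR⟩ := (hP Q hQP).exists_kraus
  have hQ : ∀ y, m * ‖y‖ ^ 2 ≤ expect (Q.elem i) y := by
    intro y
    rw [← hR, ← expect_one, ← hR1, expect_sum, expect_sum, Finset.mul_sum]
    refine Finset.sum_le_sum fun k _ => ?_
    rw [expect_conj, ← mul_one (star (R k)), expect_conj, expect_one]
    exact hm _
  have h1 := hQ (N x)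
  rw [← expect_conj, hNQ, ← expect_one, ← expect_conj, mul_one, ← hN, expect_sum] at h1
  exact h1

/-- Perturb a clean POVM by `t Z i`, for the largest `t` for which positivity holds.  If the
perturbed operators are mapped back to the POVM by a Kraus family, they have a common kernel. -/
theorem IsClean.exists_common_kernel {P : POVM ι H} (hP : P.IsClean) {Z : ι → H →L[ℂ] H}
    (hZ : ∀ i, IsSelfAdjoint (Z i))
    (hfull : ∀ i, Z i ≠ 0 → ∃ m > 0, ∀ x, m * ‖x‖ ^ 2 ≤ expect (P.elem i) x)
    (hD : ∀ t : ℝ, 0 ≤ t → ∃ D : Fin 3 → H →L[ℂ] H,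
      ∀ i, ∑ k, star (D k) * (P.elem i + (t : ℂ) • Z i) * D k = P.elem i)
    (hneg : ∃ i x, expect (Z i) x < 0) :
    ∃ (t : ℝ) (x : H), x ≠ 0 ∧ ∀ i, (P.elem i + (t : ℂ) • Z i) x = 0 := by
  -- This set is closed, and bounded because some `Z i` has a negative expectation, so it contains
  -- its supremum.
  let T : Set ℝ := {t | 0 ≤ t ∧ ∀ i x, 0 ≤ expect (P.elem i) x + t * expect (Z i) x}
  have hT0 : (0 : ℝ) ∈ T := ⟨le_rfl, fun i x => by simpa using expect_nonneg (P.elem_nonneg i) x⟩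
  have hTb : BddAbove T := by
    obtain ⟨i, x, hx⟩ := hneg
    refine ⟨expect (P.elem i) x / -expect (Z i) x, fun t ht => ?_⟩
    rw [le_div_iff₀ (by linarith)]
    have := ht.2 i x
    linarith
  have hTc : IsClosed T := by
    have : T = Set.Ici 0 ∩ ⋂ i, ⋂ x, {t | 0 ≤ expect (P.elem i) x + t * expect (Z i) x} := by
      ext t
      simp [T]
    rw [this]
    refine isClosed_Ici.inter (isClosed_iInter fun i => isClosed_iInter fun x => ?_)
    exact isClosed_le continuous_const (by fun_prop)
  have hmem : sSup T ∈ T := hTc.csSup_mem ⟨0, hT0⟩ hTb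
  set t := sSup T
  have hS : ∀ i, 0 ≤ P.elem i + (t : ℂ) • Z i := by
    intro i
    refine nonneg_of_expect_nonneg ((IsSelfAdjoint.of_nonneg (P.elem_nonneg i)).add
      (IsSelfAdjoint.smul (Complex.conj_ofReal t) (hZ i))) fun x => ?_
    rw [expect_add, expect_smul]
    exact hmem.2 i x
  by_contra! hker
  have hinj : ∀ x, (∀ i, (P.elem i + (t : ℂ) • Z i) x = 0) → x = 0 := by
    intro x hx
    by_contra h0
    obtain ⟨i, hi⟩ := hker t x h0
    exact hi (hx i)
  obtain ⟨c, hc0, hc⟩ := exists_pos_mul_norm_sq_le_expect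
    (Y := ∑ i, (P.elem i + (t : ℂ) • Z i)) (Finset.sum_nonneg fun i _ => hS i) fun x hx =>
      hinj x fun i => by
        have h0 : expect (∑ j, (P.elem j + (t : ℂ) • Z j)) x = 0 := by
          rw [expect, hx, inner_zero_right, Complex.zero_re]
        rw [expect_sum, Finset.sum_eq_zero_iff_of_nonneg fun j _ => expect_nonneg (hS j) x] at h0
        exact apply_eq_zero_of_expect_eq_zero (hS i) (h0 i (Finset.mem_univ i))
  obtain ⟨D, hD⟩ := hD t hmem.1
  have hev : ∀ i, ∀ᶠ δ in nhdsWithin (0 : ℝ) (Set.Ioi 0), ∀ x,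
      0 ≤ expect (P.elem i) x + (t + δ) * expect (Z i) x := by
    intro i
    by_cases hZi : Z i = 0
    · filter_upwards with δ x
      have := expect_nonneg (hS i) x
      rw [hZi, smul_zero, add_zero] at this
      have h0 : expect (0 : H →L[ℂ] H) x = 0 := by simp [expect]
      rw [hZi, h0, mul_zero, add_zero]
      exact this
    obtain ⟨m, hm0, hm⟩ := hfull i hZi
    -- Without a common kernel, each perturbed element with `Z i ≠ 0` stays uniformly positive, so
    -- `t` can be increased beyond the supremum.
    have hlow : ∀ x, m * c * ‖x‖ ^ 2 ≤ expect (P.elem i) x + t * expect (Z i) x := by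
      intro x
      have h1 := hP.mul_sum_expect_le hS hinj hD hm x
      rw [expect_add, expect_smul] at h1
      refine le_trans ?_ h1
      rw [mul_assoc, ← expect_sum]
      exact mul_le_mul_of_nonneg_left (hc x) hm0.le
    have hpos : 0 < m * c / (‖Z i‖ + 1) := by positivity
    filter_upwards [Ioo_mem_nhdsGT hpos] with δ hδ x
    have h1 := hlow x
    have h2 := (abs_le.1 (abs_expect_le (Z i) x)).1
    have h3 : δ * (‖Z i‖ + 1) ≤ m * c := by
      rw [← le_div_iff₀ (by positivity)]
      exact hδ.2.le
    have h4 : δ * (-(‖Z i‖ * ‖x‖ ^ 2)) ≤ δ * expect (Z i) x := mul_le_mul_of_nonneg_left h2 hδ.1.le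
    have h5 : δ * (‖Z i‖ + 1) * ‖x‖ ^ 2 ≤ m * c * ‖x‖ ^ 2 :=
      mul_le_mul_of_nonneg_right h3 (by positivity)
    nlinarith [mul_nonneg hδ.1.le (sq_nonneg ‖x‖)]
  obtain ⟨δ, hδ, hδ0⟩ := ((Filter.eventually_all.2 hev).and self_mem_nhdsWithin).exists
  replace hδ0 : 0 < δ := hδ0
  have hle : t + δ ≤ t := le_csSup hTb ⟨by linarith [hmem.1], hδ⟩
  linarith

end POVM

section

variable {H : Type*} [NormedAddCommGroup H] [InnerProductSpace ℂ H] [CompleteSpace H]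

theorem inner_star_apply_right (A : H →L[ℂ] H) (x y : H) :
    inner ℂ x (star A y) = inner ℂ (A x) y :=
  A.adjoint_inner_right x y

theorem inner_star_apply_left (A : H →L[ℂ] H) (x y : H) :
    inner ℂ (star A x) y = inner ℂ x (A y) :=
  A.adjoint_inner_left y x

end

namespace POVM

variable {ι H : Type*} [Fintype ι] [NormedAddCommGroup H] [InnerProductSpace ℂ H] [CompleteSpace H]
  [FiniteDimensional ℂ H]

/-- Relative to an idempotent `π` fixing or killing the vectors of the rank-one elements, a clean
quasi-qubit POVM has a perturbation with a common kernel, either along the off-diagonal parts of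
its elements or, when these vanish, along an off-diagonal operator added to one element. -/
theorem IsClean.exists_perturbation [Nontrivial ι] {P : POVM ι H} (hP : P.IsClean)
    (hQ : P.IsQuasiQubit) (h1 : ¬ P.IsRankOne) {ψ : ι → H}
    (hψ : ∀ i, P.RankOneAt i → P.elem i = InnerProductSpace.rankOne ℂ (ψ i) (ψ i))
    {π : H →L[ℂ] H} (hπ : π * π = π) (hπ0 : π ≠ 0) (hπ1 : π ≠ 1)
    (hπψ : ∀ i, P.RankOneAt i → π (ψ i) = ψ i ∨ π (ψ i) = 0) :
    ∃ (Z : ι → H →L[ℂ] H) (t : ℝ) (x : H), x ≠ 0 ∧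
      (∀ i, (P.elem i + (t : ℂ) • Z i) x = 0) ∧ (∀ i, P.RankOneAt i → Z i = 0) ∧
      (star π x = 0 → ∀ i, expect (Z i) x = 0) ∧
      (IsSelfAdjoint π → ∑ i, Z i = 0 ∨ ∃ i, Z i = 0) := by
  set σ : H →L[ℂ] H := 1 - π with hσ
  have hπσ : π * σ = 0 := by rw [hσ, mul_sub, mul_one, hπ, sub_self]
  have hσπ : σ * π = 0 := by rw [hσ, sub_mul, one_mul, hπ, sub_self]
  have hσσ : σ * σ = σ := by
    conv_lhs => enter [1]; rw [hσ]
    rw [sub_mul, one_mul, hπσ, sub_zero]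
  have hsσπ : star σ * star π = 0 := by rw [← star_mul, hπσ, star_zero]
  have hsπσ : star π * star σ = 0 := by rw [← star_mul, hσπ, star_zero]
  have hsσ : star σ * star σ = star σ := by rw [← star_mul, hσσ]
  have hfull : ∀ i, ¬ P.RankOneAt i → ∃ m > 0, ∀ x, m * ‖x‖ ^ 2 ≤ expect (P.elem i) x :=
    fun i hi => exists_pos_mul_norm_sq_le_expect_of_opRank (P.elem_nonneg i)
      ((hQ i).resolve_right hi)
  have hsa : ∀ i, star (P.elem i) = P.elem i := fun i => IsSelfAdjoint.of_nonneg (P.elem_nonneg i)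
  have hoff : ∀ i, P.RankOneAt i → π * P.elem i * star σ = 0 := by
    intro i hi
    ext x
    simp only [hψ i hi, mul_apply_eq_comp, InnerProductSpace.rankOne_apply, map_smul,
      ContinuousLinearMap.star_eq_adjoint, ContinuousLinearMap.adjoint_inner_right, zero_apply]
    rcases hπψ i hi with h | h
    · simp [hσ, h]
    · simp [h]
  have hblocks : ∀ X : H →L[ℂ] H, (π * X * star σ + σ * X * star π) +
      (π * X * star π + σ * X * star σ) = X := by
    intro X
    simp only [hσ, star_sub, star_one]
    noncomm_ring
  by_cases hcase : ∃ i, π * P.elem i * star σ ≠ 0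
  · obtain ⟨i₀, hi₀⟩ := hcase
    -- The off-diagonal parts are scaled by `1 + t`. They vanish at rank-one outcomes, where `π` or
    -- `σ` kills `ψ i`.
    set Z : ι → H →L[ℂ] H := fun i => π * P.elem i * star σ + σ * P.elem i * star π with hZ
    have hstar : ∀ i, star (π * P.elem i * star σ) = σ * P.elem i * star π := by
      intro i
      rw [star_mul, star_mul, star_star, hsa, mul_assoc]
    have hZ0 : ∀ i, P.RankOneAt i → Z i = 0 := by
      intro i hi
      simp only [Z]
      rw [← hstar, hoff i hi, star_zero, add_zero]
    have hdiag : ∀ i, π * Z i * star π + σ * Z i * star σ = 0 := by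
      intro i
      have e1 : π * Z i * star π = (π * π) * P.elem i * (star σ * star π) +
          (π * σ) * P.elem i * (star π * star π) := by simp only [Z]; noncomm_ring
      have e2 : σ * Z i * star σ = (σ * π) * P.elem i * (star σ * star σ) +
          (σ * σ) * P.elem i * (star π * star σ) := by simp only [Z]; noncomm_ring
      rw [e1, e2, hsσπ, hπσ, hσπ, hsπσ]
      simp
    obtain ⟨t, x, hx, htx⟩ := hP.exists_common_kernel (Z := Z)
      (fun i => by
        rw [IsSelfAdjoint, hZ]
        simp only
        rw [star_add, ← hstar, star_star, add_comm])
      (fun i hi => hfull i fun h => hi (hZ0 i h))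
      (fun t ht => by
        -- The pinching sends `P i + t Z i` to `P i - Z i`, and with these weights the `Z i` terms
        -- cancel.
        obtain ⟨D, hD⟩ := exists_kraus_pinching π σ (a := 1 / (1 + t)) (b := t / (1 + t))
          (by positivity) (by positivity)
        refine ⟨D, fun i => ?_⟩
        rw [hD]
        have e : π * (P.elem i + (t : ℂ) • Z i) * star π + σ * (P.elem i + (t : ℂ) • Z i) * star σ =
            P.elem i - Z i := by
          have e1 : π * (P.elem i + (t : ℂ) • Z i) * star π +
              σ * (P.elem i + (t : ℂ) • Z i) * star σ =
              (π * P.elem i * star π + σ * P.elem i * star σ) +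
              (t : ℂ) • (π * Z i * star π + σ * Z i * star σ) := by
            simp only [mul_add, add_mul, mul_smul_comm, smul_mul_assoc, smul_add]
            abel
          rw [e1, hdiag, smul_zero, add_zero, eq_sub_iff_add_eq, add_comm]
          exact hblocks _
        have ht' : (1 + t : ℂ) ≠ 0 := by
          have : (1 + t : ℝ) ≠ 0 := by positivity
          exact_mod_cast this
        rw [e]
        push_cast
        have e2 : (1 / (1 + t) : ℂ) • (P.elem i + (t : ℂ) • Z i) +
            (t / (1 + t) : ℂ) • (P.elem i - Z i) =
            ((1 / (1 + t) : ℂ) + t / (1 + t)) • P.elem i := by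
          rw [smul_add, smul_sub, smul_smul, add_smul, one_div_mul_eq_div]
          abel
        rw [e2, ← add_div, div_self ht', one_smul])
      (by
        refine ⟨i₀, ?_⟩
        obtain ⟨v, hv⟩ : ∃ v, (π * P.elem i₀ * star σ) v ≠ 0 := by
          by_contra! h
          exact hi₀ (ContinuousLinearMap.ext h)
        set w := (π * P.elem i₀ * star σ) v
        -- The off-diagonal operator sends this vector to `w`, and its inner product with `w` is
        -- `-‖w‖ ^ 2`, so `Z i₀` has expectation `-2 ‖w‖ ^ 2` there.
        refine ⟨star σ v - star π w, ?_⟩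
        have e1 : (π * P.elem i₀ * star σ) (star σ v - star π w) = w := by
          have a1 : star σ (star σ v) = star σ v := DFunLike.congr_fun hsσ v
          have a2 : star σ (star π w) = 0 := DFunLike.congr_fun hsσπ w
          rw [mul_apply_eq_comp, map_sub, a1, a2, sub_zero]
          rfl
        have e2 : inner ℂ (star σ v - star π w) w = -inner ℂ w w := by
          have a1 : π w = w := by
            simp only [w, mul_apply_eq_comp]
            exact DFunLike.congr_fun hπ _
          have a2 : σ w = 0 := by rw [hσ]; simp [a1]
          rw [inner_sub_left, inner_star_apply_left, inner_star_apply_left, a1, a2,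
            inner_zero_right, zero_sub]
        have e3 : inner ℂ (star σ v - star π w) ((σ * P.elem i₀ * star π) (star σ v - star π w)) =
            -inner ℂ w w := by
          rw [← hstar, inner_star_apply_right, e1, ← inner_conj_symm, e2, map_neg, inner_conj_symm]
        rw [expect, hZ]
        simp only
        rw [add_apply, inner_add_right, e1, e2, e3, inner_self_eq_norm_sq_to_K]
        have : 0 < ‖w‖ := norm_pos_iff.2 hv
        have e4 : (-(‖w‖ : ℂ) ^ 2 + -(‖w‖ : ℂ) ^ 2).re = -(2 * ‖w‖ ^ 2) := by
          norm_cast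
          ring
        erw [e4]
        have : 0 < ‖w‖ ^ 2 := by positivity
        linarith)
    refine ⟨Z, t, x, hx, htx, hZ0, fun h i => ?_, fun h => Or.inl ?_⟩
    · rw [expect, hZ]
      simp only
      rw [add_apply, inner_add_right, ← hstar, inner_star_apply_right]
      have : inner ℂ x ((π * P.elem i * star σ) x) = 0 := by
        rw [mul_assoc, mul_apply_eq_comp, ← inner_star_apply_left, h, inner_zero_left]
      rw [← inner_conj_symm (_ : H) x, this]
      simp
    · rw [hZ, Finset.sum_add_distrib, ← Finset.sum_mul, ← Finset.mul_sum, ← Finset.sum_mul,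
        ← Finset.mul_sum, P.sum_eq_one, mul_one, mul_one]
      have hs : star σ = σ := by rw [hσ, star_sub, star_one, h.star_eq]
      rw [hs, h.star_eq, hπσ, hσπ, add_zero]
  · push Not at hcase
    -- Summing the vanishing off-diagonal parts gives `π * star σ = 0`, so `π` is an orthogonal
    -- projection.
    have hπs : star π = π := by
      have h0 : π * star σ = 0 := by
        rw [← mul_one π, ← P.sum_eq_one, Finset.mul_sum, Finset.sum_mul]
        exact Finset.sum_eq_zero fun i _ => hcase i
      have h2 : π = π * star π := by
        rw [hσ, star_sub, star_one, mul_sub, mul_one, sub_eq_zero] at h0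
        exact h0
      rw [h2, star_mul, star_star]
    have hσs : star σ = σ := by rw [hσ, star_sub, star_one, hπs]
    obtain ⟨i₀, hi₀⟩ : ∃ i, ¬ P.RankOneAt i := by
      rw [IsRankOne] at h1
      push Not at h1
      exact h1
    obtain ⟨a, ha, ha'⟩ : ∃ a, a ≠ 0 ∧ π a = a := by
      obtain ⟨y, hy⟩ : ∃ y, π y ≠ 0 := by
        by_contra! h
        exact hπ0 (ContinuousLinearMap.ext h)
      exact ⟨π y, hy, DFunLike.congr_fun hπ y⟩
    obtain ⟨b, hb, hb'⟩ : ∃ b, b ≠ 0 ∧ π b = 0 := by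
      obtain ⟨y, hy⟩ : ∃ y, σ y ≠ 0 := by
        by_contra! h
        exact hπ1 (sub_eq_zero.1 (ContinuousLinearMap.ext h : 1 - π = 0)).symm
      exact ⟨σ y, hy, DFunLike.congr_fun hπσ y⟩
    have hab : inner ℂ a b = 0 := by
      rw [← ha', ← inner_star_apply_right, hπs, hb', inner_zero_right]
    have hba : inner ℂ b a = 0 := inner_eq_zero_symm.1 hab
    -- With every element block diagonal, an off-diagonal term is supplied at one full-rank outcome.
    -- The pinching alone removes it.
    set Z₀ : H →L[ℂ] H := InnerProductSpace.rankOne ℂ a b + InnerProductSpace.rankOne ℂ b a with hZ₀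
    have hZ₀x : ∀ x, Z₀ x = inner ℂ b x • a + inner ℂ a x • b := fun x => by simp [Z₀]
    have hdiag : π * Z₀ * star π + σ * Z₀ * star σ = 0 := by
      rw [hπs, hσs]
      ext x
      have b1 : inner ℂ b (π x) = 0 := by
        rw [← inner_star_apply_left, hπs, hb', inner_zero_left]
      have b2 : inner ℂ a (π x) = inner ℂ a x := by
        rw [← inner_star_apply_left, hπs, ha']
      have b3 : inner ℂ a (σ x) = 0 := by simp [hσ, b2]
      have b4 : σ a = 0 := by simp [hσ, ha']
      simp only [add_apply, mul_apply_eq_comp, hZ₀x, b1, b3, zero_smul, zero_add, add_zero,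
        map_smul, hb', b4, smul_zero, zero_apply]
    classical
    set Z : ι → H →L[ℂ] H := fun i => if i = i₀ then Z₀ else 0 with hZ
    have hZne : ∀ i, i ≠ i₀ → Z i = 0 := fun i hi => if_neg hi
    have hZi₀ : Z i₀ = Z₀ := if_pos rfl
    obtain ⟨t, x, hx, htx⟩ := hP.exists_common_kernel (Z := Z)
      (fun i => by
        by_cases hi : i = i₀
        · rw [hi, hZi₀, IsSelfAdjoint, hZ₀, star_add, ContinuousLinearMap.star_eq_adjoint,
            ContinuousLinearMap.star_eq_adjoint, InnerProductSpace.adjoint_rankOne,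
            InnerProductSpace.adjoint_rankOne, add_comm]
        · rw [hZne i hi]
          exact IsSelfAdjoint.zero _)
      (fun i hi => by
        by_cases hi' : i = i₀
        · exact hi' ▸ hfull i₀ hi₀
        · exact absurd (hZne i hi') hi)
      (fun t ht => by
        obtain ⟨D, hD⟩ := exists_kraus_pinching π σ (a := 0) (b := 1) le_rfl zero_le_one
        refine ⟨D, fun i => ?_⟩
        rw [hD, Complex.ofReal_zero, zero_smul, zero_add, Complex.ofReal_one, one_smul]
        have e1 : π * (P.elem i + (t : ℂ) • Z i) * star π +
            σ * (P.elem i + (t : ℂ) • Z i) * star σ =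
            (π * P.elem i * star π + σ * P.elem i * star σ) +
            (t : ℂ) • (π * Z i * star π + σ * Z i * star σ) := by
          simp only [mul_add, add_mul, mul_smul_comm, smul_mul_assoc, smul_add]
          abel
        have e2 : π * Z i * star π + σ * Z i * star σ = 0 := by
          by_cases hi : i = i₀
          · rw [hi, hZi₀, hdiag]
          · rw [hZne i hi]
            simp
        have e3 : σ * P.elem i * star π = 0 := by
          have := congrArg star (hcase i)
          rw [star_mul, star_mul, star_star, hsa, star_zero] at this
          rw [mul_assoc, this]
        have e4 := hblocks (P.elem i)
        rw [hcase, e3, add_zero, zero_add] at e4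
        rw [e1, e2, smul_zero, add_zero, e4])
      (by
        refine ⟨i₀, a - b, ?_⟩
        rw [hZi₀, expect, hZ₀x, inner_sub_right, inner_sub_right, hba, hab, zero_sub, sub_zero,
          inner_add_right, inner_smul_right, inner_smul_right, inner_sub_left, inner_sub_left, hba,
          hab, zero_sub, sub_zero, inner_self_eq_norm_sq_to_K, inner_self_eq_norm_sq_to_K]
        have e4 : (-(‖b‖ : ℂ) ^ 2 * (‖a‖ : ℂ) ^ 2 + (‖a‖ : ℂ) ^ 2 * -(‖b‖ : ℂ) ^ 2).re =
            -(2 * (‖a‖ ^ 2 * ‖b‖ ^ 2)) := by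
          norm_cast
          ring
        erw [e4]
        have : 0 < ‖a‖ := norm_pos_iff.2 ha
        have : 0 < ‖b‖ := norm_pos_iff.2 hb
        have : 0 < ‖a‖ ^ 2 * ‖b‖ ^ 2 := by positivity
        linarith)
    refine ⟨Z, t, x, hx, htx, fun i hi => hZne i fun h => hi₀ (h ▸ hi), fun h i => ?_,
      fun _ => Or.inr ?_⟩
    · by_cases hi : i = i₀
      · have e1 : inner ℂ a x = 0 := by
          rw [← ha', ← inner_star_apply_right, h, inner_zero_right]
        rw [hi, hZi₀, expect, hZ₀x, e1, zero_smul, add_zero, inner_smul_right,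
          inner_eq_zero_symm.1 e1, mul_zero, Complex.zero_re]
      · rw [hZne i hi]
        simp [expect]
    · obtain ⟨j, hj⟩ := exists_ne i₀
      exact ⟨j, hZne j hj⟩

theorem not_isClean [Nontrivial ι] (hd : 2 ≤ Module.finrank ℂ H) {P : POVM ι H}
    (hQ : P.IsQuasiQubit) (h1 : ¬ P.IsRankOne) {ψ : ι → H}
    (hψ : ∀ i, P.RankOneAt i → P.elem i = InnerProductSpace.rankOne ℂ (ψ i) (ψ i))
    (h : Decomposes fun i : {i // P.RankOneAt i} => ψ i) : ¬ P.IsClean := by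
  intro hP
  have hfull : ∀ i, ¬ P.RankOneAt i → ∃ m > 0, ∀ x, m * ‖x‖ ^ 2 ≤ expect (P.elem i) x :=
    fun i hi => exists_pos_mul_norm_sq_le_expect_of_opRank (P.elem_nonneg i)
      ((hQ i).resolve_right hi)
  have hpos : ∀ i x, x ≠ 0 → ¬ P.RankOneAt i → expect (P.elem i) x ≠ 0 := by
    intro i x hx hi h0
    obtain ⟨m, hm, hmx⟩ := hfull i hi
    have := hmx x
    rw [h0] at this
    have h2 : 0 < ‖x‖ := norm_pos_iff.2 hx
    have h3 : 0 < m * ‖x‖ ^ 2 := by positivity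
    linarith
  set W : Submodule ℂ H := Submodule.span ℂ (Set.range fun i : {i // P.RankOneAt i} => ψ i)
  have hψW : ∀ i, P.RankOneAt i → ψ i ∈ W := fun i hi => Submodule.subset_span ⟨⟨i, hi⟩, rfl⟩
  have hxW : ∀ x : H, (∀ i, P.RankOneAt i → P.elem i x = 0) → x ∈ Wᗮ := by
    intro x hx
    have hle : W ≤ LinearMap.ker (innerₛₗ ℂ x) := by
      refine Submodule.span_le.2 ?_
      rintro _ ⟨i, rfl⟩
      have h2 : expect (P.elem i) x = 0 := by
        rw [expect, hx i i.2, inner_zero_right, Complex.zero_re]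
      rw [hψ i i.2, expect_rankOne, sq_eq_zero_iff, norm_eq_zero] at h2
      exact inner_eq_zero_symm.1 h2
    exact (Submodule.mem_orthogonal' _ _).2 fun u hu => hle hu
  by_cases hW : W = ⊤
  -- When the vectors span, a common kernel vector is orthogonal to all of them and must vanish.
  · obtain ⟨π, hπ, hπ0, hπ1, hπψ⟩ := h
    let p : H →L[ℂ] H := LinearMap.toContinuousLinearMap π
    obtain ⟨Z, t, x, hx, htx, hZ, -, -⟩ := hP.exists_perturbation hQ h1 hψ (π := p)
      (ContinuousLinearMap.ext fun x => LinearMap.congr_fun hπ.eq x)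
      (fun h0 => hπ0 (LinearMap.ext fun x => DFunLike.congr_fun h0 x))
      (fun h0 => hπ1 (LinearMap.ext fun x => DFunLike.congr_fun h0 x))
      (fun i hi => hπψ ⟨i, hi⟩)
    have := hxW x fun i hi => by
      have := htx i
      rwa [hZ i hi, smul_zero, add_zero] at this
    rw [hW, Submodule.top_orthogonal_eq_bot] at this
    exact hx ((Submodule.mem_bot ℂ).1 this)
  -- When they do not span, the given splitting is replaced by the orthogonal projection onto `W`,
  -- or onto an arbitrary line if `W = ⊥`.
  · have : Nontrivial H := Module.nontrivial_of_finrank_pos (R := ℂ) (by omega)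
    obtain ⟨A, hA0, hA1, hAW, hAW'⟩ : ∃ A : Submodule ℂ H, A ≠ ⊥ ∧ A ≠ ⊤ ∧ W ≤ A ∧
        (W ≠ ⊥ → A = W) := by
      by_cases hW0 : W = ⊥
      · obtain ⟨y, hy⟩ := exists_ne (0 : H)
        refine ⟨Submodule.span ℂ {y}, by simpa using hy, fun h0 => ?_, hW0 ▸ bot_le,
          fun h0 => absurd hW0 h0⟩
        have h2 := finrank_span_singleton (K := ℂ) hy
        rw [h0, finrank_top] at h2
        omega
      · exact ⟨W, hW0, hW, le_rfl, fun _ => rfl⟩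
    have hAr : ∀ x, A.starProjection x = x ↔ x ∈ A := fun x =>
      Submodule.starProjection_eq_self_iff
    have hsa : IsSelfAdjoint A.starProjection := isSelfAdjoint_starProjection A
    obtain ⟨Z, t, x, hx, htx, hZ, hZx, hZs⟩ := hP.exists_perturbation hQ h1 hψ
      (π := A.starProjection)
      (ContinuousLinearMap.ext fun x => (hAr _).2 (A.starProjection_apply_mem x))
      (fun h0 => hA0 ((Submodule.eq_bot_iff _).2 fun x hx => by
        rw [← (hAr x).2 hx, h0, zero_apply]))
      (fun h0 => hA1 (Submodule.eq_top_iff'.2 fun x => (hAr x).1 (by rw [h0, one_apply_eq_self])))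
      (fun i hi => Or.inl ((hAr _).2 (hAW (hψW i hi))))
    have hxW' := hxW x fun i hi => by
      have := htx i
      rwa [hZ i hi, smul_zero, add_zero] at this
    by_cases hW0 : W = ⊥
    · have hno : ∀ i, ¬ P.RankOneAt i := by
        intro i hi
        have h2 := hψW i hi
        rw [hW0, Submodule.mem_bot] at h2
        obtain ⟨φ, hφ, hφ'⟩ := P.exists_rankOne hi
        rw [hψ i hi, h2, map_zero, eq_comm] at hφ'
        replace hφ' := InnerProductSpace.rankOne_eq_zero.1 hφ'
        exact hφ (hφ'.elim id id)
      -- All elements are full-rank here. Either the perturbed elements still sum to the identity,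
      -- or some element is unperturbed and injective; neither allows a common kernel.
      rcases hZs hsa with h2 | ⟨j, hj⟩
      · have h3 : ∑ i, (P.elem i + (t : ℂ) • Z i) = 1 := by
          rw [Finset.sum_add_distrib, ← Finset.smul_sum, h2, smul_zero, add_zero, P.sum_eq_one]
        refine hx ?_
        rw [← one_apply_eq_self (F := H →L[ℂ] H) x, ← h3, sum_apply]
        exact Finset.sum_eq_zero fun i _ => htx i
      · have h3 := htx j
        rw [hj, smul_zero, add_zero] at h3
        exact hpos j x hx (hno j) (by rw [expect, h3, inner_zero_right, Complex.zero_re])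
    -- Here `x` is orthogonal to the range of the projection, so the perturbation has zero
    -- expectation at `x`, and so would a full-rank element.
    · rw [← hAW' hW0] at hxW'
      have h2 : star A.starProjection x = 0 := by
        rw [hsa.star_eq]
        exact (Submodule.starProjection_apply_eq_zero_iff _).2 hxW'
      obtain ⟨i, hi⟩ : ∃ i, ¬ P.RankOneAt i := by
        rw [IsRankOne] at h1
        push Not at h1
        exact h1
      refine hpos i x hx hi ?_
      have h3 : expect (P.elem i + (t : ℂ) • Z i) x = 0 := by
        rw [expect, htx, inner_zero_right, Complex.zero_re]
      rwa [expect_add, expect_smul, hZx h2, mul_zero, add_zero] at h3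

end POVM

/-! ### Block decompositions maintained by the loop -/

section Blocks

variable {V : Type*} [AddCommGroup V] [Module ℂ V]

/-- `C` is a decomposition of `V` into nonzero subspaces such that each vector of `L` lies in one of
them, and such that the operators having all vectors of `L` as eigenvectors are scalar on each of
them. -/
structure IsBlockDecomposition (C : Finset (Submodule ℂ V)) (L : Set V) : Prop where
  covers : ∀ x ∈ L, ∃ U ∈ C, x ∈ U
  indep : C.SupIndep id
  bot_notMem : ⊥ ∉ C
  sup_eq_top : C.sup id = ⊤
  scalar : ∀ T : V →ₗ[ℂ] V, (∀ x ∈ L, ∃ c : ℂ, T x = c • x) →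
    ∀ U ∈ C, ∃ c : ℂ, U ≤ Module.End.eigenspace T c

theorem eq_zero_of_sum_eq_zero_of_supIndep {C : Finset (Submodule ℂ V)} (hC : C.SupIndep id)
    {w : Submodule ℂ V → V} (hw : ∀ U ∈ C, w U ∈ U) (h : ∑ U ∈ C, w U = 0) {U : Submodule ℂ V}
    (hU : U ∈ C) : w U = 0 := by
  classical
  have h1 := Finset.supIndep_iff_disjoint_erase.1 hC U hU
  have h2 : w U = -∑ U' ∈ C.erase U, w U' := by
    rw [eq_neg_iff_add_eq_zero, Finset.add_sum_erase C w hU, h]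
  refine Submodule.disjoint_def.1 h1 _ (hw U hU) ?_
  rw [h2]
  refine neg_mem (Submodule.sum_mem _ fun U' hU' => ?_)
  exact Finset.le_sup (f := id) hU' (hw U' (Finset.mem_of_mem_erase hU'))

theorem exists_eq_sum_of_sup_eq_top {C : Finset (Submodule ℂ V)} (hC : C.sup id = ⊤) (x : V) :
    ∃ v : Submodule ℂ V → V, (∀ U ∈ C, v U ∈ U) ∧ x = ∑ U ∈ C, v U := by
  have hx : x ∈ ⨆ U ∈ C, (id U : Submodule ℂ V) := by
    rw [← Finset.sup_eq_iSup, hC]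
    exact Submodule.mem_top
  obtain ⟨μ, hμ⟩ := (Submodule.mem_iSup_finset_iff_exists_sum _ _).1 hx
  exact ⟨fun U => μ U, fun U _ => (μ U).2, hμ.symm⟩

namespace IsBlockDecomposition

variable {C : Finset (Submodule ℂ V)} {L : Set V}

open Classical in
-- If `T x = c • x` and `T` is the scalar `a U` on each block, independence gives `(a U - c) • v U =
-- 0`, so all blocks meeting `x` carry the same scalar `c`. The condition `x ≠ 0` prevents `J` from
-- being empty and `⊥` from being inserted.
theorem insert (h : IsBlockDecomposition C L) {x : V} (hx : x ≠ 0) {v : Submodule ℂ V → V}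
    (hv : ∀ U ∈ C, v U ∈ U) (hxv : x = ∑ U ∈ C, v U) {J : Finset (Submodule ℂ V)}
    (hJ : J = C.filter fun U => v U ≠ 0) :
    IsBlockDecomposition (Insert.insert (J.sup id) (C \ J)) (Insert.insert x L) := by
  have hJC : J ⊆ C := hJ ▸ Finset.filter_subset _ _
  have hxJ : x = ∑ U ∈ J, v U := by rw [hxv, hJ, Finset.sum_filter_ne_zero]
  have hxJ' : x ∈ J.sup id := by
    rw [hxJ]
    exact Submodule.sum_mem _ fun U hU => Finset.le_sup (f := id) hU (hv U (hJC hU))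
  refine ⟨?_, ?_, ?_, ?_, ?_⟩
  · rintro y (rfl | hy)
    · exact ⟨_, Finset.mem_insert_self _ _, hxJ'⟩
    · obtain ⟨U, hU, hyU⟩ := h.covers y hy
      by_cases hUJ : U ∈ J
      · exact ⟨_, Finset.mem_insert_self _ _, Finset.le_sup (f := id) hUJ hyU⟩
      · exact ⟨U, Finset.mem_insert_of_mem (Finset.mem_sdiff.2 ⟨hU, hUJ⟩), hyU⟩
  · exact (h.indep.subset Finset.sdiff_subset).insert
      (h.indep.disjoint_sup_sup hJC Finset.sdiff_subset Finset.disjoint_sdiff)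
  · rw [Finset.mem_insert]
    rintro (h0 | h0)
    · rw [← h0, Submodule.mem_bot] at hxJ'
      exact hx hxJ'
    · exact h.bot_notMem (Finset.sdiff_subset h0)
  · rw [Finset.sup_insert, id, ← Finset.sup_union, Finset.union_sdiff_of_subset hJC, h.sup_eq_top]
  · intro T hT U hU
    rw [Finset.mem_insert] at hU
    rcases hU with rfl | hU
    · obtain ⟨c, hc⟩ := hT x (Set.mem_insert _ _)
      have hs := h.scalar T fun y hy => hT y (Set.mem_insert_of_mem _ hy)
      refine ⟨c, Finset.sup_le fun U hU => ?_⟩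
      obtain ⟨a, ha⟩ := hs U (hJC hU)
      have h0 : ∑ U ∈ C, (T (v U) - c • v U) = 0 := by
        rw [Finset.sum_sub_distrib, ← map_sum, ← Finset.smul_sum, ← hxv, hc, sub_self]
      have h1 := eq_zero_of_sum_eq_zero_of_supIndep h.indep (fun U hU => by
        obtain ⟨a, ha⟩ := hs U hU
        rw [Module.End.mem_eigenspace_iff.1 (ha (hv U hU))]
        exact sub_mem (Submodule.smul_mem _ _ (hv U hU)) (Submodule.smul_mem _ _ (hv U hU))) h0
        (hJC hU)
      rw [Module.End.mem_eigenspace_iff.1 (ha (hv U (hJC hU))), ← sub_smul, smul_eq_zero] at h1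
      rw [hJ, Finset.mem_filter] at hU
      rcases h1 with h1 | h1
      · rw [← sub_eq_zero.1 h1]
        exact ha
      · exact absurd h1 hU.2
    · exact h.scalar T (fun y hy => hT y (Set.mem_insert_of_mem _ hy)) U (Finset.sdiff_subset hU)

/-- A splitting idempotent has every `ψ i` as an eigenvector, so it is scalar on the single block,
hence `0` or `1`. -/
theorem not_decomposes (h : IsBlockDecomposition C L) (hC : C = {⊤}) {K : Type*} {ψ : K → V}
    (hL : ∀ x ∈ L, ∃ i, x = ψ i) : ¬ Decomposes ψ := by
  rintro ⟨π, hπ, hπ0, hπ1, hπψ⟩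
  obtain ⟨c, hc⟩ := h.scalar π (fun x hx => by
    obtain ⟨i, rfl⟩ := hL x hx
    rcases hπψ i with h | h
    · exact ⟨1, by rw [h, one_smul]⟩
    · exact ⟨0, by rw [h, zero_smul]⟩) ⊤ (hC ▸ Finset.mem_singleton_self _)
  have : π = c • 1 := LinearMap.ext fun x => by
    simpa using Module.End.mem_eigenspace_iff.1 (hc (Submodule.mem_top (x := x)))
  rcases eq_zero_or_eq_one_of_isIdempotentElem_smul hπ this with h | h
  · exact hπ0 h
  · exact hπ1 h

/-- One proper block and the sum of the others form the splitting. -/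
theorem decomposes [Nontrivial V] (h : IsBlockDecomposition C L) (hC : C ≠ {⊤}) {K : Type*}
    {ψ : K → V} (hL : ∀ i, ψ i ∈ L) : Decomposes ψ := by
  classical
  obtain ⟨U, hU, hU1⟩ : ∃ U ∈ C, U ≠ ⊤ := by
    by_contra! h0
    refine hC (Finset.eq_singleton_iff_nonempty_unique_mem.2 ⟨?_, h0⟩)
    rw [Finset.nonempty_iff_ne_empty]
    rintro rfl
    have := h.sup_eq_top
    rw [Finset.sup_empty] at this
    exact bot_ne_top this
  refine decomposes_of_isCompl (A := U) (B := (C.erase U).sup id)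
    ⟨Finset.supIndep_iff_disjoint_erase.1 h.indep U hU, codisjoint_iff.2 ?_⟩
    (fun h0 => h.bot_notMem (h0 ▸ hU)) hU1 fun i => ?_
  · have := Finset.sup_insert (s := C.erase U) (f := id) (b := U)
    rw [Finset.insert_erase hU, h.sup_eq_top] at this
    exact this.symm
  · obtain ⟨U', hU', hi⟩ := h.covers _ (hL i)
    by_cases hUU : U' = U
    · exact Or.inl (hUU ▸ hi)
    · exact Or.inr (Finset.le_sup (f := id) (Finset.mem_erase.2 ⟨hUU, hU'⟩) hi)

open Classical in
theorem of_basis {ι : Type*} {ψ : ι → V} {b : List ι}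
    (hli : LinearIndependent ℂ fun k : Fin b.length => ψ (b.get k))
    (hspan : Submodule.span ℂ (Set.range fun k : Fin b.length => ψ (b.get k)) = ⊤) :
    IsBlockDecomposition (b.map fun i => Submodule.span ℂ {ψ i}).toFinset
      {x | x ∈ b.map ψ} := by
  have hmem : ∀ U, U ∈ (b.map fun i => Submodule.span ℂ {ψ i}).toFinset ↔
      ∃ k : Fin b.length, Submodule.span ℂ {ψ (b.get k)} = U := by
    intro U
    rw [List.mem_toFinset, List.mem_map]
    constructor
    · rintro ⟨i, hi, rfl⟩
      obtain ⟨k, rfl⟩ := List.get_of_mem hi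
      exact ⟨k, rfl⟩
    · rintro ⟨k, rfl⟩
      exact ⟨_, List.get_mem _ _, rfl⟩
  have himage : (b.map fun i => Submodule.span ℂ {ψ i}).toFinset =
      Finset.univ.image fun k : Fin b.length => Submodule.span ℂ {ψ (b.get k)} := by
    ext U
    rw [hmem]
    simp
  refine ⟨?_, ?_, ?_, ?_, ?_⟩
  · intro x hx
    obtain ⟨i, hi, rfl⟩ := List.mem_map.1 hx
    exact ⟨_, List.mem_toFinset.2 (List.mem_map.2 ⟨i, hi, rfl⟩),
      Submodule.mem_span_singleton_self _⟩
  · rw [himage]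
    refine Finset.SupIndep.image ?_
    exact iSupIndep_iff_supIndep_univ.1 hli.iSupIndep_span_singleton
  · rw [hmem]
    rintro ⟨k, hk⟩
    exact hli.ne_zero k (Submodule.span_singleton_eq_bot.1 hk)
  · rw [← top_le_iff, ← hspan, Submodule.span_le]
    rintro _ ⟨k, rfl⟩
    exact Finset.le_sup (f := id) ((hmem _).2 ⟨k, rfl⟩) (Submodule.mem_span_singleton_self _)
  · intro T hT U hU
    obtain ⟨k, rfl⟩ := (hmem U).1 hU
    obtain ⟨c, hc⟩ := hT (ψ (b.get k)) (List.mem_map.2 ⟨_, List.get_mem _ _, rfl⟩)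
    refine ⟨c, (Submodule.span_singleton_le_iff_mem _ _).2 (Module.End.mem_eigenspace_iff.2 hc)⟩

end IsBlockDecomposition

end Blocks

/-! ### Invariant, progress and termination of the algorithm -/

namespace POVM

variable {ι H : Type*} [Fintype ι] [NormedAddCommGroup H] [InnerProductSpace ℂ H]

theorem exists_represents [FiniteDimensional ℂ H] [CompleteSpace H] (P : POVM ι H) :
    ∃ ψ : ι → H, P.Represents ψ ∧
      ∀ i, P.RankOneAt i → P.elem i = InnerProductSpace.rankOne ℂ (ψ i) (ψ i) := by
  classical
  have h : ∀ i, ∃ φ : H, P.RankOneAt i → P.elem i = InnerProductSpace.rankOne ℂ φ φ := by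
    intro i
    by_cases hi : P.RankOneAt i
    · obtain ⟨φ, -, hφ⟩ := P.exists_rankOne hi
      exact ⟨φ, fun _ => hφ⟩
    · exact ⟨0, fun h => absurd h hi⟩
  choose ψ hψ using h
  exact ⟨ψ, fun i hi => ⟨1, by rw [hψ i hi, Complex.ofReal_one, one_smul]⟩, hψ⟩

theorem Represents.exists_smul {P : POVM ι H} {ψ : ι → H} (h : P.Represents ψ) {i : ι}
    (hi : P.RankOneAt i) : ψ i ≠ 0 ∧ ∃ a : ℂ, a ≠ 0 ∧
      P.elem i = a • InnerProductSpace.rankOne ℂ (ψ i) (ψ i) := by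
  obtain ⟨a, ha⟩ := h i hi
  have h0 : P.elem i ≠ 0 := by
    intro h0
    rw [RankOneAt, opRank, h0, ContinuousLinearMap.toLinearMap_zero, LinearMap.range_zero,
      finrank_bot] at hi
    exact zero_ne_one hi
  refine ⟨fun h1 => h0 ?_, a, fun h1 => h0 ?_, ha⟩
  · rw [ha, h1, map_zero, smul_zero]
  · rw [ha, h1, zero_smul]

variable [FiniteDimensional ℂ H]

/-- The supports of the rank-one elements totally determine the space if and only if the
corresponding vectors are not in the union of two proper complementary subspaces. -/
theorem Represents.rankOneSupportsDetermine_iff (hd : 2 ≤ Module.finrank ℂ H) {P : POVM ι H}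
    {ψ : ι → H} (h : P.Represents ψ) :
    P.RankOneSupportsDetermine ↔ ¬ Decomposes fun i : {i // P.RankOneAt i} => ψ i := by
  have : Nontrivial H := Module.nontrivial_of_finrank_pos (R := ℂ) (by omega)
  have hF : (fun i : {i // P.RankOneAt i} => supp (P.elem i)) =
      fun i : {i // P.RankOneAt i} => Submodule.span ℂ {ψ i} := by
    funext i
    obtain ⟨-, a, ha, hi⟩ := h.exists_smul i.2
    rw [hi, supp_smul_rankOne ha]
  rw [RankOneSupportsDetermine, hF]
  refine ⟨fun hT hD => not_totallyDetermines_span_singleton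
    (fun i : {i // P.RankOneAt i} => (h.exists_smul i.2).1) hD hT, fun hD => ?_⟩
  refine totallyDetermines_span_singleton ?_ hD
  by_contra hs
  exact hD (decomposes_of_span_ne_top hd hs)

/-- What is known when the loop of the algorithm is entered or continued. -/
def LoopInvariant (P : POVM ι H) (C : Finset (Submodule ℂ H)) (rest : List H) : Prop :=
  ¬ P.IsRankOne ∧ ∃ ψ : ι → H, P.Represents ψ ∧ ∃ L : Set H,
    (∀ x, x ∈ L ∨ x ∈ rest ↔ ∃ i : {i // P.RankOneAt i}, x = ψ i) ∧ IsBlockDecomposition C L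

/-- The invariant of the algorithm. -/
def AlgInvariant (P : POVM ι H) : AlgState ι H → Prop
  | .checkRankOne => True
  | .checkSpan => ¬ P.IsRankOne
  | .chooseBasis ψ => ¬ P.IsRankOne ∧ P.Represents ψ ∧
      Submodule.span ℂ (ψ '' {i | P.RankOneAt i}) = ⊤
  | .loop C rest => C ≠ {⊤} ∧ P.LoopInvariant C rest
  | .checkExit C rest => P.LoopInvariant C rest
  | .exit .clean => P.IsRankOne ∨ P.RankOneSupportsDetermine
  | .exit .notClean => ¬ (P.IsRankOne ∨ P.RankOneSupportsDetermine)

theorem AlgInvariant.step (hd : 2 ≤ Module.finrank ℂ H) {P : POVM ι H} {s t : AlgState ι H}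
    (h : P.Step s t) (hs : P.AlgInvariant s) : P.AlgInvariant t := by
  have : Nontrivial H := Module.nontrivial_of_finrank_pos (R := ℂ) (by omega)
  cases h with
  | rankOne h => exact Or.inl h
  | notRankOne h => exact h
  | notSpanning ψ hψ hspan =>
    rintro (h | h)
    · exact hs h
    · refine (hψ.rankOneSupportsDetermine_iff hd).1 h (decomposes_of_span_ne_top hd ?_)
      rwa [Set.image_eq_range] at hspan
  | spanning ψ hψ hspan => exact ⟨hs, hψ, hspan⟩
  | init ψ b rest hnodup hmem hli hspan =>
    obtain ⟨h1, hψ, -⟩ := hs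
    refine ⟨fun h0 => ?_, h1, ψ, hψ, _, fun x => ?_, IsBlockDecomposition.of_basis hli hspan⟩
    -- The initial blocks are lines, and none is the whole space since `d ≥ 2`; the loop may thus
    -- start without an exit test.
    · have h2 : ⊤ ∈ (b.map fun i => Submodule.span ℂ {ψ i}).toFinset :=
        h0 ▸ Finset.mem_singleton_self _
      obtain ⟨i, -, hi⟩ := List.mem_map.1 (List.mem_toFinset.1 h2)
      have h3 := finrank_span_le_card (R := ℂ) ({ψ i} : Set H)
      rw [hi, finrank_top] at h3
      simp at h3
      omega
    · rw [Set.mem_ofPred_eq, List.mem_map, List.mem_map]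
      constructor
      · rintro (⟨i, hi, rfl⟩ | ⟨i, hi, rfl⟩)
        · exact ⟨⟨i, (hmem i).1 (List.mem_append_left _ hi)⟩, rfl⟩
        · exact ⟨⟨i, (hmem i).1 (List.mem_append_right _ hi)⟩, rfl⟩
      · rintro ⟨⟨i, hi⟩, rfl⟩
        rcases List.mem_append.1 ((hmem i).2 hi) with h | h
        · exact Or.inl ⟨i, h, rfl⟩
        · exact Or.inr ⟨i, h, rfl⟩
  | update C x rest v J hv hx hJ =>
    obtain ⟨-, h1, ψ, hψ, L, hL, hC⟩ := hs
    have hx0 : x ≠ 0 := by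
      obtain ⟨i, rfl⟩ := (hL x).1 (Or.inr List.mem_cons_self)
      exact (hψ.exists_smul i.2).1
    refine ⟨h1, ψ, hψ, _, fun y => ?_, hC.insert hx0 hv hx hJ⟩
    rw [← hL, List.mem_cons, Set.mem_insert_iff]
    tauto
  | exitClean C rest hC =>
    obtain ⟨h1, ψ, hψ, L, hL, hCL⟩ := hs
    exact Or.inr ((hψ.rankOneSupportsDetermine_iff hd).2
      (hCL.not_decomposes hC fun x hx => (hL x).1 (Or.inl hx)))
  | nextRound C rest hC => exact ⟨hC, hs⟩
  | loopDone C =>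
    obtain ⟨hC, h1, ψ, hψ, L, hL, hCL⟩ := hs
    rintro (h | h)
    · exact h1 h
    · refine (hψ.rankOneSupportsDetermine_iff hd).1 h (hCL.decomposes hC fun i => ?_)
      rcases (hL (ψ i)).2 ⟨i, rfl⟩ with h | h
      · exact h
      · simp at h

theorem exists_step_chooseBasis (P : POVM ι H) {ψ : ι → H}
    (hspan : Submodule.span ℂ (ψ '' {i | P.RankOneAt i}) = ⊤) :
    ∃ t, P.Step (.chooseBasis ψ) t := by
  classical
  obtain ⟨κ, a, ha, hsp, hli⟩ := exists_linearIndependent' ℂ fun i : {i // P.RankOneAt i} => ψ i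
  let s : Finset ι := Finset.univ.filter fun i => ∃ k, (a k : ι) = i
  let r : Finset ι := Finset.univ.filter fun i => P.RankOneAt i ∧ i ∉ s
  have hs : ∀ i, i ∈ s.toList ↔ ∃ k, (a k : ι) = i := fun i => by simp [s]
  have hget : ∀ j : Fin s.toList.length, ∃ k, (a k : ι) = s.toList.get j :=
    fun j => (hs _).1 (List.get_mem _ _)
  choose g hg using hget
  have hfun : (fun j : Fin s.toList.length => ψ (s.toList.get j)) =
      ((fun i : {i // P.RankOneAt i} => ψ i) ∘ a) ∘ g := by
    funext j
    simp only [Function.comp_apply]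
    rw [hg]
  refine ⟨_, Step.init ψ s.toList r.toList ?_ ?_ ?_ ?_⟩
  · refine List.Nodup.append s.nodup_toList r.nodup_toList fun i hi hi' => ?_
    rw [Finset.mem_toList] at hi hi'
    exact (Finset.mem_filter.1 hi').2.2 hi
  · intro i
    rw [List.mem_append, Finset.mem_toList, Finset.mem_toList]
    constructor
    · rintro (h | h)
      · obtain ⟨k, rfl⟩ := (Finset.mem_filter.1 h).2
        exact (a k).2
      · exact (Finset.mem_filter.1 h).2.1
    · intro h
      by_cases hi : i ∈ s
      · exact Or.inl hi
      · exact Or.inr (Finset.mem_filter.2 ⟨Finset.mem_univ _, h, hi⟩)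
  · rw [hfun]
    refine hli.comp g fun j j' hjj => ?_
    have h1 : s.toList.get j = s.toList.get j' := by rw [← hg, ← hg, hjj]
    exact (List.nodup_iff_injective_get.1 s.nodup_toList) h1
  · rw [← top_le_iff]
    rw [Set.image_eq_range] at hspan
    refine (hspan.symm.trans hsp.symm).le.trans (Submodule.span_mono ?_)
    rintro _ ⟨k, rfl⟩
    obtain ⟨j, hj⟩ := List.get_of_mem ((hs (a k)).2 ⟨k, rfl⟩)
    exact ⟨j, by simp only [hj, Function.comp_apply]⟩

theorem AlgInvariant.progress [CompleteSpace H] {P : POVM ι H} {s : AlgState ι H}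
    (hs : P.AlgInvariant s) : (∃ t, P.Step s t) ∨ ∃ r, s = .exit r := by
  cases s with
  | checkRankOne =>
    left
    by_cases h : P.IsRankOne
    · exact ⟨_, .rankOne h⟩
    · exact ⟨_, .notRankOne h⟩
  | checkSpan =>
    left
    obtain ⟨ψ, hψ, -⟩ := P.exists_represents
    by_cases h : Submodule.span ℂ (ψ '' {i | P.RankOneAt i}) = ⊤
    · exact ⟨_, .spanning ψ hψ h⟩
    · exact ⟨_, .notSpanning ψ hψ h⟩
  | chooseBasis ψ => exact Or.inl (P.exists_step_chooseBasis hs.2.2)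
  | loop C rest =>
    left
    cases rest with
    | nil => exact ⟨_, .loopDone C⟩
    | cons x rest =>
      obtain ⟨-, -, ψ, -, L, -, hC⟩ := hs
      obtain ⟨v, hv, hx⟩ := exists_eq_sum_of_sup_eq_top hC.sup_eq_top x
      exact ⟨_, .update C x rest v _ hv hx rfl⟩
  | checkExit C rest =>
    left
    by_cases h : C = {⊤}
    · exact ⟨_, .exitClean C rest h⟩
    · exact ⟨_, .nextRound C rest h⟩
  | exit r => exact Or.inr ⟨r, rfl⟩

/-- A bound for the number of steps that the algorithm can still make. -/
def algMeasure (ι : Type*) {H : Type*} [Fintype ι] [NormedAddCommGroup H] [InnerProductSpace ℂ H] :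
    AlgState ι H → ℕ
  | .checkRankOne => 2 * Fintype.card ι + 4
  | .checkSpan => 2 * Fintype.card ι + 3
  | .chooseBasis _ => 2 * Fintype.card ι + 2
  | .loop _ rest => 2 * rest.length + 1
  | .checkExit _ rest => 2 * rest.length + 2
  | .exit _ => 0

theorem Step.algMeasure_lt {P : POVM ι H} {s t : AlgState ι H} (h : P.Step s t) :
    algMeasure ι t < algMeasure ι s := by
  cases h with
  | init ψ b rest hnodup hmem hli hspan =>
    have h1 := hnodup.length_le_card
    rw [List.length_append] at h1
    simp only [algMeasure, List.length_map]
    omega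
  | _ => simp only [algMeasure, List.length_cons]; omega

theorem algorithmDecides [CompleteSpace H] (hd : 2 ≤ Module.finrank ℂ H) (P : POVM ι H) :
    P.AlgorithmDecides (P.IsRankOne ∨ P.RankOneSupportsDetermine) := by
  constructor
  · rintro ⟨s, -, hs⟩
    have h : ∀ n, algMeasure ι (s n) + n ≤ algMeasure ι (s 0) := by
      intro n
      induction n with
      | zero => simp
      | succ n ih =>
        have := (hs n).algMeasure_lt
        omega
    have := h (algMeasure ι (s 0) + 1)
    omega
  · intro t ht hstuck
    have hinv : P.AlgInvariant t := by
      clear hstuck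
      induction ht with
      | refl => trivial
      | tail _ h ih => exact ih.step hd h
    rcases hinv.progress with ⟨t', ht'⟩ | ⟨r, rfl⟩
    · exact absurd ht' (hstuck t')
    · cases r with
      | clean => exact Or.inl ⟨hinv, rfl⟩
      | notClean => exact Or.inr ⟨hinv, rfl⟩

end POVM

/-! ### Cleanness criterion and cleanness-equivalence -/

namespace POVM

variable {ι H : Type*} [Fintype ι] [NormedAddCommGroup H] [InnerProductSpace ℂ H] [CompleteSpace H]
  [FiniteDimensional ℂ H]

theorem unitaryEquiv_of_cleaner [Nontrivial H] {P Q : POVM ι H}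
    (hP : P.IsRankOne ∨ P.RankOneSupportsDetermine) (h : Q.Cleaner P) : P.UnitaryEquiv Q :=
  hP.elim (fun hP => unitaryEquiv_of_isRankOne hP h)
    fun hP => unitaryEquiv_of_rankOneSupportsDetermine hP h

theorem isClean_iff [Nontrivial ι] (hd : 2 ≤ Module.finrank ℂ H) {P : POVM ι H}
    (hP : P.IsQuasiQubit) : P.IsClean ↔ P.IsRankOne ∨ P.RankOneSupportsDetermine := by
  have : Nontrivial H := Module.nontrivial_of_finrank_pos (R := ℂ) (by omega)
  refine ⟨fun hclean => ?_, fun h Q hQ => (unitaryEquiv_of_cleaner h hQ).cleaner⟩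
  by_contra! h
  obtain ⟨ψ, hψ, hψ'⟩ := P.exists_represents
  rw [hψ.rankOneSupportsDetermine_iff hd, not_not] at h
  exact not_isClean hd hP h.1 hψ' h.2 hclean

theorem elem_eq_of_subsingleton [Subsingleton ι] (P : POVM ι H) (i : ι) : P.elem i = 1 := by
  rw [← P.sum_eq_one, Fintype.sum_subsingleton _ i]

theorem IsClean.cleanEquiv_iff (hd : 2 ≤ Module.finrank ℂ H) {P : POVM ι H} (hP : P.IsQuasiQubit)
    (hclean : P.IsClean) (Q : POVM ι H) : P.CleanEquiv Q ↔ P.UnitaryEquiv Q := by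
  have : Nontrivial H := Module.nontrivial_of_finrank_pos (R := ℂ) (by omega)
  refine ⟨fun h => ?_, UnitaryEquiv.cleanEquiv⟩
  -- With a single outcome the only POVM is the identity, so the two are equal; the criterion
  -- `isClean_iff` needs two outcomes.
  rcases subsingleton_or_nontrivial ι with hι | hι
  · exact ⟨1, one_mem _, fun i => by simp [elem_eq_of_subsingleton]⟩
  · exact unitaryEquiv_of_cleaner ((isClean_iff hd hP).1 hclean) h.1

end POVM

end CleanPOVM

theorem theorem6 {ι H : Type*} [Fintype ι] [NormedAddCommGroup H] [InnerProductSpace ℂ H]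
    [CompleteSpace H] [FiniteDimensional ℂ H] (hd : 2 ≤ Module.finrank ℂ H)
    (P : CleanPOVM.POVM ι H) (hP : P.IsQuasiQubit) :
    (Nontrivial ι → (P.IsClean ↔ P.IsRankOne ∨ P.RankOneSupportsDetermine)) ∧
    P.AlgorithmDecides (P.IsRankOne ∨ P.RankOneSupportsDetermine) ∧
    (P.IsClean → ∀ Q : CleanPOVM.POVM ι H, P.CleanEquiv Q ↔ P.UnitaryEquiv Q) :=
  ⟨fun _ => CleanPOVM.POVM.isClean_iff hd hP, CleanPOVM.POVM.algorithmDecides hd P,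
    fun h => CleanPOVM.POVM.IsClean.cleanEquiv_iff hd hP h⟩
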